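/- Let $I\subseteq\mathbb R$ be an interval, let $\bar I$ be its closure in $[-\infty,\infty]$, and let $y$ lie in the interior of $I$. On a filtered probability space $(\Omega,\mathcal F,(\mathcal F_t)_{t\ge 0},\mathbb P)$ let $Y=(Y_t)_{t\ge0}$ be an adapted, time-homogeneous strong Markov process with continuous paths in $I$ and $Y_0=y$ (almost surely), which is a regular diffusion on $I$: started from any interior point of $I$, it reaches every point of $I$ with positive probability; and the endpoints of $I$ that belong to $I$ are absorbing. Let $\mathcal T$ be the set of all stopping times $\tau$ (possibly infinite) such that $Y_\tau:=\lim_{t\to\infty}Y_{t\wedge\tau}$ exists almost surely in $[-\infty,\infty]$, and let $\mathcal T_T$ be the set of pure threshold rules, i.e. of those $\tau\in\mathcal T$ of the form $\tau=\tau_{\beta,\gamma}=\inf\{u\ge0: Y_u\notin(\beta,\gamma)\}$ with $\beta,\gamma\in\bar I$, $\beta\le y\le\gamma$. Let $Q(\mathcal T)$ be the set of laws of $Y_\tau$, $\tau\in\mathcal T$ (probability measures on $[-\infty,\infty]$, carried by $\bar I$). For a real-valued $V$ on stopping times and a set $\mathcal S$ of stopping times put $V_*(\mathcal S)=\sup_{\tau\in\mathcal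 S}V(\tau)\in[-\infty,\infty]$. Suppose that $V$ is law invariant, that is, there is $H:Q(\mathcal T)\to\mathbb R$ such that $V(\tau)=H(\mathcal L(Y_\tau))$ for all $\tau\in\mathcal T$. Suppose that $H$ is quasi-convex, that is, $H(\lambda\mu_1+(1-\lambda)\mu_2)\le\max\{H(\mu_1),H(\mu_2)\}$ for $\lambda\in(0,1)$ whenever the three measures belong to $Q(\mathcal T)$, and that $H$ is lower semicontinuous with respect to weak convergence; for the latter it is enough that $H(\mu)\le\limsup_n H(\mu_n)$ whenever $\mu_n\Rightarrow\mu$ with $\mu_n,\mu\in Q(\mathcal T)$. Then pure threshold rules suffice: $$V_*(\mathcal T)=V_*(\mathcal T_T).$$ -/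

import Mathlib

open MeasureTheory ProbabilityTheory Filter Topology
open scoped NNReal ENNReal

/-- The space of continuous paths `[0,∞) → ℝ` carries the σ-algebra generated by the evaluation
maps. -/
instance pathMeasurableSpace : MeasurableSpace C(ℝ≥0, ℝ) :=
  MeasurableSpace.comap (fun f t => f t) MeasurableSpace.pi

theorem measurable_path_eval (t : ℝ≥0) : Measurable (fun f : C(ℝ≥0, ℝ) => f t) :=
  (measurable_pi_apply t).comp (comap_measurable _)

/-- The path `f` seen from time `s` onwards, `u ↦ f (s + u)`. -/
def shiftPath (s : ℝ≥0) (f : C(ℝ≥0, ℝ)) : C(ℝ≥0, ℝ) where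
  toFun u := f (s + u)

/-- The natural filtration of the coordinate process on path space. -/
noncomputable def pathFiltration : Filtration ℝ≥0 pathMeasurableSpace :=
  Filtration.natural (fun t (f : C(ℝ≥0, ℝ)) => f t)
    (fun t => (measurable_path_eval t).stronglyMeasurable)

/-- The process `Y` with continuous paths is time-homogeneous strong Markov with respect to the
filtration `𝓕`, with `κ z` the law of the whole path when started from `z`: for each `𝓕`-stopping
time `τ`, on `{τ < ∞}` the conditional law of the path after time `τ`, given the σ-algebra of
events prior to `τ`, is `κ (Y_τ)`. -/
def IsStrongMarkov {Ω : Type*} {m : MeasurableSpace Ω} (κ : Kernel ℝ C(ℝ≥0, ℝ))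
    (𝓕 : Filtration ℝ≥0 m) (P : Measure Ω) (Y : Ω → C(ℝ≥0, ℝ)) : Prop :=
  ∀ (τ : Ω → WithTop ℝ≥0) (hτ : IsStoppingTime 𝓕 τ) (A : Set Ω),
    MeasurableSet[hτ.measurableSpace] A → A ⊆ {ω | τ ω ≠ ⊤} →
    ∀ Γ : Set C(ℝ≥0, ℝ), MeasurableSet Γ →
      P (A ∩ {ω | shiftPath (τ ω).untopA (Y ω) ∈ Γ}) =
        ∫⁻ ω in A, κ (Y ω (τ ω).untopA) Γ ∂P

/-- `κ` is (the family of path laws of) a regular time-homogeneous diffusion on the interval `I`: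
a strong Markov process with continuous paths in `I` which, from each interior point, reaches each
point of `I` with positive probability, and for which those endpoints of `I` that belong to `I`
are absorbing. -/
structure IsRegularDiffusion (I : Set ℝ) (κ : Kernel ℝ C(ℝ≥0, ℝ)) : Prop where
  /-- the state space is an interval -/
  ordConnected : I.OrdConnected
  isProbabilityMeasure : ∀ z ∈ I, IsProbabilityMeasure (κ z)
  start : ∀ z ∈ I, ∀ᵐ f ∂(κ z), f 0 = z
  mem_state : ∀ z ∈ I, ∀ᵐ f ∂(κ z), ∀ t, f t ∈ I
  strongMarkov : ∀ z ∈ I, IsStrongMarkov κ pathFiltration (κ z) id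
  regular : ∀ z ∈ interior I, ∀ w ∈ I, 0 < κ z {f | ∃ t, f t = w}
  absorbing : ∀ z ∈ I \ interior I, ∀ᵐ f ∂(κ z), ∀ t, f t = z

section Stopping

variable {Ω : Type*} {m : MeasurableSpace Ω}

/-- The class `𝒯` of stopping times `τ` (possibly infinite) for which `lim_{t → ∞} Y_{t ∧ τ}`
exists almost surely, as an extended real number. -/
def stoppingClass (𝓕 : Filtration ℝ≥0 m) (P : Measure Ω) (Y : Ω → C(ℝ≥0, ℝ)) :
    Set (Ω → WithTop ℝ≥0) :=
  {τ | IsStoppingTime 𝓕 τ ∧ ∀ᵐ ω ∂P, ∃ l : EReal,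
    Tendsto (fun t : ℝ≥0 => ((stoppedProcess (fun t ω => Y ω t) τ t ω : ℝ) : EReal)) atTop (𝓝 l)}

/-- The stopped value `Y_τ = lim_{t → ∞} Y_{t ∧ τ}`, as an extended real number. (Where the limit
exists it equals the upper limit; it always exists where `τ < ∞`.) -/
noncomputable def exitValue (Y : Ω → C(ℝ≥0, ℝ)) (τ : Ω → WithTop ℝ≥0) (ω : Ω) : EReal :=
  limsup (fun t : ℝ≥0 => ((stoppedProcess (fun t ω => Y ω t) τ t ω : ℝ) : EReal)) atTop

/-- The first time that `Y` is outside `(β, γ)`, `inf {u ≥ 0 : Y_u ∉ (β, γ)}` (`⊤` if there is no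
such time). -/
noncomputable def thresholdTime (Y : Ω → C(ℝ≥0, ℝ)) (β γ : EReal) : Ω → WithTop ℝ≥0 :=
  hittingAfter (fun t ω => Y ω t) {z : ℝ | ¬ (β < (z : EReal) ∧ (z : EReal) < γ)} 0

/-- The class `𝒯_T` of pure threshold stopping times: the elements of `𝒯` that are the first exit
time from `(β, γ)` for some `β ≤ y ≤ γ` in the closure of `I` in the extended real line. -/
def thresholdClass (𝓕 : Filtration ℝ≥0 m) (P : Measure Ω) (Y : Ω → C(ℝ≥0, ℝ))
    (I : Set ℝ) (y : ℝ) : Set (Ω → WithTop ℝ≥0) :=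
  {τ | τ ∈ stoppingClass 𝓕 P Y ∧ ∃ β γ : EReal,
    β ∈ closure ((fun z : ℝ => (z : EReal)) '' I) ∧ γ ∈ closure ((fun z : ℝ => (z : EReal)) '' I) ∧
    β ≤ (y : EReal) ∧ (y : EReal) ≤ γ ∧ τ = thresholdTime Y β γ}

/-- The set `Q(𝒮)` of the laws of `Y_τ`, for `τ ∈ 𝒮`. -/
def exitLaws (P : Measure Ω) (Y : Ω → C(ℝ≥0, ℝ)) (S : Set (Ω → WithTop ℝ≥0)) :
    Set (ProbabilityMeasure EReal) :=
  {μ | ∃ τ ∈ S, HasLaw (exitValue Y τ) (μ : Measure EReal) P}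

/-- The optimal value `V_*(𝒮) = sup_{τ ∈ 𝒮} V(τ)`, in the extended real line. -/
noncomputable def optimalValue (V : (Ω → WithTop ℝ≥0) → ℝ) (S : Set (Ω → WithTop ℝ≥0)) : EReal :=
  ⨆ τ ∈ S, (V τ : EReal)

end Stopping

/-- Quasi-convexity of `H` on the set `Q` of probability measures:
`H (a μ₁ + (1 - a) μ₂) ≤ max (H μ₁) (H μ₂)`. -/
def IsQuasiconvexOn (Q : Set (ProbabilityMeasure EReal)) (H : ProbabilityMeasure EReal → ℝ) :
    Prop :=
  ∀ μ₁ ∈ Q, ∀ μ₂ ∈ Q, ∀ μ ∈ Q, ∀ a : ℝ, 0 < a → a < 1 →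
    (μ : Measure EReal) = ENNReal.ofReal a • (μ₁ : Measure EReal)
      + ENNReal.ofReal (1 - a) • (μ₂ : Measure EReal) →
    H μ ≤ max (H μ₁) (H μ₂)

/-- The weak form of lower semicontinuity of `H` on `Q`: if `μ_n → μ` weakly in `Q` then
`H μ ≤ limsup H μ_n`. (Lower semicontinuity gives this with `liminf` in place of `limsup`.) -/
def IsLimsupLscOn (Q : Set (ProbabilityMeasure EReal)) (H : ProbabilityMeasure EReal → ℝ) : Prop :=
  ∀ (ν : ℕ → ProbabilityMeasure EReal) (μ : ProbabilityMeasure EReal), (∀ n, ν n ∈ Q) → μ ∈ Q →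
    Tendsto ν atTop (𝓝 μ) → (H μ : EReal) ≤ limsup (fun n => (H (ν n) : EReal)) atTop

-- Threshold rules belong to the larger class, so only one inequality has content: `H` at the law of
-- `Y_τ` must be bounded by the supremum over threshold rules, for every admissible `τ`.
--
-- On a compact interval `[l, r]` inside the interior of `I`, the probability `s = hitProb κ r l` of
-- reaching `r` before `l` is a scale function. Regularity gives almost sure exit from `[l, r]` and
-- positive probability of exit on either side. The strong Markov property then makes `s` strictly
-- increasing with the intermediate value property, and `s(Y)` satisfies optional stopping
-- (`hitProb_eq_sum`) at stopping times that do not go past the exit from `[l, r]` and at which the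
-- position takes finitely many values.
--
-- For laws with finitely many atoms in `[l, r]`, optional stopping says that `s` has mean `s(y)`.
-- Conversely every such law with this mean is embedded by a stopping time (`exists_embedding`), so
-- all of them lie in the set on which `H` is quasi-convex. They form, on a fixed finite set of
-- atoms, a polytope cut out by two linear equations. Its extreme points have at most two atoms, and
-- a law of this kind with at most two atoms is the exit law from an interval. Descending to extreme
-- points, `H` is dominated by its value at some threshold rule (`exists_threshold_ge`).
--
-- A general `τ` is reduced to this case by stopping on exit from the `n`-th interval of an
-- exhaustion and then waiting for the next point of a fine finite net (`exists_discretization`).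
-- The stopped values converge almost surely (`tendsto_min_exit`), with absorption at the end points
-- taking care of paths that leave the interior in finite time. Hence the laws converge weakly, and
-- semicontinuity concludes.

attribute [-simp] ENNReal.some_eq_coe ENNReal.some_eq_coe'

/-! ### Hitting times of closed sets -/

/-- The first time from `u` onwards at which the path `f` is in `C`. -/
noncomputable def hitFrom (C : Set ℝ) (u : WithTop ℝ≥0) (f : C(ℝ≥0, ℝ)) : WithTop ℝ≥0 :=
  sInf {v | ∃ t : ℝ≥0, v = t ∧ u ≤ t ∧ f t ∈ C}

theorem exists_mem_of_mem_uIcc (f : C(ℝ≥0, ℝ)) {u t : ℝ≥0} (hut : u ≤ t) {x : ℝ}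
    (hx : x ∈ Set.uIcc (f u) (f t)) : ∃ v, u ≤ v ∧ v ≤ t ∧ f v = x := by
  obtain ⟨v, hv, hvx⟩ := intermediate_value_uIcc f.continuous.continuousOn hx
  rw [Set.uIcc_of_le hut] at hv
  exact ⟨v, hv.1, hv.2, hvx⟩

theorem hitFrom_le_of_mem {C : Set ℝ} {u : WithTop ℝ≥0} {f : C(ℝ≥0, ℝ)} {t : ℝ≥0}
    (hu : u ≤ t) (ht : f t ∈ C) : hitFrom C u f ≤ t :=
  sInf_le ⟨t, rfl, hu, ht⟩

theorem le_hitFrom (C : Set ℝ) (u : WithTop ℝ≥0) (f : C(ℝ≥0, ℝ)) : u ≤ hitFrom C u f := by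
  refine le_sInf ?_
  rintro _ ⟨t, rfl, hu, -⟩
  exact hu

theorem exists_hitFrom_eq {C : Set ℝ} (hC : IsClosed C) {u : WithTop ℝ≥0} {f : C(ℝ≥0, ℝ)}
    (h : ∃ t : ℝ≥0, u ≤ t ∧ f t ∈ C) :
    ∃ t : ℝ≥0, hitFrom C u f = t ∧ u ≤ t ∧ f t ∈ C ∧ ∀ v : ℝ≥0, u ≤ v → f v ∈ C → t ≤ v := by
  set S : Set ℝ≥0 := {t | u ≤ t ∧ f t ∈ C} with hS
  have hclosed : IsClosed S := by
    have h1 : IsClosed {t : ℝ≥0 | u ≤ (t : WithTop ℝ≥0)} := by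
      induction u with
      | top => simp
      | coe u =>
        simp only [WithTop.coe_le_coe]
        exact isClosed_Ici (a := u)
    exact h1.inter (hC.preimage f.continuous)
  have hmem : sInf S ∈ S := hclosed.csInf_mem h (OrderBot.bddBelow S)
  have hle : ∀ v : ℝ≥0, u ≤ v → f v ∈ C → sInf S ≤ v := fun v h1 h2 =>
    csInf_le (OrderBot.bddBelow S) ⟨h1, h2⟩
  refine ⟨sInf S, le_antisymm (hitFrom_le_of_mem hmem.1 hmem.2) (le_sInf ?_), hmem.1, hmem.2, hle⟩
  rintro _ ⟨t, rfl, hu, ht⟩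
  exact WithTop.coe_le_coe.2 (hle t hu ht)

theorem hitFrom_le_iff {C : Set ℝ} (hC : IsClosed C) {u : WithTop ℝ≥0} {f : C(ℝ≥0, ℝ)}
    {t : ℝ≥0} : hitFrom C u f ≤ t ↔ ∃ v : ℝ≥0, v ≤ t ∧ u ≤ v ∧ f v ∈ C := by
  constructor
  · intro h
    by_cases hex : ∃ t : ℝ≥0, u ≤ t ∧ f t ∈ C
    · obtain ⟨v, hv, h1, h2, -⟩ := exists_hitFrom_eq hC hex
      rw [hv] at h
      exact ⟨v, WithTop.coe_le_coe.1 h, h1, h2⟩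
    · have : hitFrom C u f = ⊤ := by
        refine sInf_eq_top.2 ?_
        rintro _ ⟨t, rfl, h1, h2⟩
        exact absurd ⟨t, h1, h2⟩ hex
      rw [this] at h
      simp at h
  · rintro ⟨v, hvt, h1, h2⟩
    exact (hitFrom_le_of_mem h1 h2).trans (WithTop.coe_le_coe.2 hvt)

theorem hitFrom_eq_coe {C : Set ℝ} (hC : IsClosed C) {u : WithTop ℝ≥0} {f : C(ℝ≥0, ℝ)}
    {t : ℝ≥0} (h : hitFrom C u f = t) :
    u ≤ t ∧ f t ∈ C ∧ ∀ v : ℝ≥0, u ≤ v → f v ∈ C → t ≤ v := by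
  obtain ⟨v, hvt, h1, h2⟩ := (hitFrom_le_iff hC).1 h.le
  obtain ⟨s, hs, h3, h4, h5⟩ := exists_hitFrom_eq hC ⟨v, h1, h2⟩
  have : t = s := WithTop.coe_injective (h.symm.trans hs)
  subst this
  exact ⟨h3, h4, h5⟩

theorem hitFrom_eq_coe_of {C : Set ℝ} (hC : IsClosed C) {u : WithTop ℝ≥0} {f : C(ℝ≥0, ℝ)}
    {t : ℝ≥0} (hu : u ≤ t) (ht : f t ∈ C) (hmin : ∀ v : ℝ≥0, u ≤ v → f v ∈ C → t ≤ v) :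
    hitFrom C u f = t := by
  obtain ⟨s, hs, h3, h4, h5⟩ := exists_hitFrom_eq hC ⟨t, hu, ht⟩
  rw [hs, le_antisymm (h5 t hu ht) (hmin s h3 h4)]

/-- Closedness of `C` and continuity of paths replace right-continuity of the filtration: by
compactness, `C` is visited in the time interval `[τ, t]` exactly when the path comes arbitrarily
close to `C` at times of a countable set within it. -/
theorem IsClosed.isStoppingTime_hitFrom {Ω : Type*} {m : MeasurableSpace Ω}
    {𝓕 : Filtration ℝ≥0 m} {Y : Ω → C(ℝ≥0, ℝ)} {C : Set ℝ} (hC : IsClosed C)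
    (hY : Adapted 𝓕 (fun t ω => Y ω t)) {τ : Ω → WithTop ℝ≥0} (hτ : IsStoppingTime 𝓕 τ) :
    IsStoppingTime 𝓕 (fun ω => hitFrom C (τ ω) (Y ω)) := by
  intro t
  -- `Metric.infDist` to the empty set is `0`, so the distance criterion below would fail for it.
  rcases C.eq_empty_or_nonempty with rfl | hne
  · have : {ω | hitFrom ∅ (τ ω) (Y ω) ≤ t} = ∅ := by
      ext ω; simp [hitFrom_le_iff]
    rw [this]; exact @MeasurableSet.empty _ (𝓕 t)
  obtain ⟨D, hDc, hDd⟩ := TopologicalSpace.exists_countable_dense ℝ≥0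
  -- The time `t` itself must be added to the dense set: if `C` is first visited at `t`, there may
  -- be no dense time in `[τ, t]` close to it.
  have key : {ω | hitFrom C (τ ω) (Y ω) ≤ t} =
      ⋂ n : ℕ, ⋃ q ∈ insert t (D ∩ Set.Iic t),
        {ω | τ ω ≤ q} ∩ {ω | Metric.infDist (Y ω q) C < 1 / ((n : ℝ) + 1)} := by
    ext ω
    simp only [Set.mem_ofPred_eq, hitFrom_le_iff hC, Set.mem_iInter, Set.mem_iUnion,
      Set.mem_inter_iff, exists_prop]
    constructor
    · rintro ⟨v, hvt, hτv, hv⟩ n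
      have hcont : Continuous fun q => Metric.infDist (Y ω q) C :=
        (Metric.continuous_infDist_pt C).comp (Y ω).continuous
      have hopen : IsOpen {q | Metric.infDist (Y ω q) C < 1 / ((n : ℝ) + 1)} :=
        isOpen_lt hcont continuous_const
      have hvO : v ∈ {q | Metric.infDist (Y ω q) C < 1 / ((n : ℝ) + 1)} := by
        simp only [Set.mem_ofPred_eq, Metric.infDist_zero_of_mem hv]
        positivity
      rcases hvt.eq_or_lt with rfl | hlt
      · exact ⟨v, Set.mem_insert _ _, hτv, hvO⟩
      · obtain ⟨ε, hε, hball⟩ := exists_Ico_subset_of_mem_nhds (hopen.mem_nhds hvO) ⟨t, hlt⟩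
        have hlt' : v < min ε t := lt_min hε hlt
        obtain ⟨q, hqD, hq1, hq2⟩ := hDd.exists_between hlt'
        refine ⟨q, Set.mem_insert_of_mem _ ⟨hqD, (hq2.trans_le (min_le_right _ _)).le⟩,
          hτv.trans (WithTop.coe_le_coe.2 hq1.le), hball ⟨hq1.le, hq2.trans_le (min_le_left _ _)⟩⟩
    · intro h
      choose q hq hτq hqd using h
      have hqt : ∀ n, q n ∈ Set.Icc 0 t := by
        intro n
        rcases hq n with h | h
        · simp [h]
        · exact ⟨zero_le, h.2⟩
      obtain ⟨v, hv, φ, hφ, hlim⟩ := isCompact_Icc.tendsto_subseq hqt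
      refine ⟨v, hv.2, ?_, ?_⟩
      · have h1 := (WithTop.continuous_coe.tendsto v).comp hlim
        exact ge_of_tendsto' h1 fun n => hτq (φ n)
      · rw [hC.mem_iff_infDist_zero hne]
        have h1 : Tendsto (fun n => Metric.infDist (Y ω (q (φ n))) C) atTop
            (𝓝 (Metric.infDist (Y ω v) C)) :=
          (((Metric.continuous_infDist_pt C).comp (Y ω).continuous).tendsto v).comp hlim
        have h2 : Tendsto (fun n => 1 / ((φ n : ℝ) + 1)) atTop (𝓝 0) :=
          (tendsto_one_div_add_atTop_nhds_zero_nat (𝕜 := ℝ)).comp hφ.tendsto_atTop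
        exact le_antisymm (le_of_tendsto_of_tendsto' h1 h2 fun n => (hqd (φ n)).le)
          Metric.infDist_nonneg
  rw [key]
  refine MeasurableSet.iInter fun n => MeasurableSet.biUnion
    ((hDc.mono Set.inter_subset_left).insert t) fun q hq => ?_
  have hqt : q ≤ t := by
    rcases hq with h | h
    · exact h.le
    · exact h.2
  refine MeasurableSet.inter (𝓕.mono hqt _ (hτ q)) ?_
  refine 𝓕.mono hqt _ ?_
  exact measurableSet_lt ((Metric.continuous_infDist_pt C).measurable.comp (hY q)) measurable_const

/-! ### Measurability of hitting events on path space -/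

/-- The paths that reach `b`, and do so before they reach `a`. -/
def hitsBefore (b a : ℝ) : Set C(ℝ≥0, ℝ) := {f | ∃ t, f t = b ∧ ∀ v ≤ t, f v ≠ a}

theorem adapted_pathFiltration : Adapted pathFiltration (fun t (f : C(ℝ≥0, ℝ)) => id f t) :=
  fun t => (Filtration.stronglyAdapted_natural
    (fun t => (measurable_path_eval t).stronglyMeasurable) t).measurable

theorem measurable_hitFrom {C : Set ℝ} (hC : IsClosed C) : Measurable (hitFrom C 0) :=
  (hC.isStoppingTime_hitFrom adapted_pathFiltration
    (isStoppingTime_const pathFiltration 0)).measurable'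

theorem measurableSet_exists_le_mem {C : Set ℝ} (hC : IsClosed C) (t : ℝ≥0) :
    MeasurableSet {f : C(ℝ≥0, ℝ) | ∃ v ≤ t, f v ∈ C} := by
  have : {f : C(ℝ≥0, ℝ) | ∃ v ≤ t, f v ∈ C} = hitFrom C 0 ⁻¹' Set.Iic (t : WithTop ℝ≥0) := by
    ext f
    simp only [Set.mem_ofPred_eq, Set.mem_preimage, Set.mem_Iic]
    rw [hitFrom_le_iff hC]
    simp
  rw [this]
  exact measurable_hitFrom hC measurableSet_Iic

theorem measurableSet_exists_mem {C : Set ℝ} (hC : IsClosed C) :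
    MeasurableSet {f : C(ℝ≥0, ℝ) | ∃ v, f v ∈ C} := by
  have : {f : C(ℝ≥0, ℝ) | ∃ v, f v ∈ C} = ⋃ n : ℕ, {f | ∃ v ≤ (n : ℝ≥0), f v ∈ C} := by
    ext f
    simp only [Set.mem_ofPred_eq, Set.mem_iUnion]
    constructor
    · rintro ⟨v, hv⟩
      obtain ⟨n, hn⟩ := exists_nat_ge v
      exact ⟨n, v, hn, hv⟩
    · rintro ⟨n, v, -, hv⟩
      exact ⟨v, hv⟩
  rw [this]
  exact MeasurableSet.iUnion fun n => measurableSet_exists_le_mem hC n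

theorem measurableSet_hitsBefore (b a : ℝ) : MeasurableSet (hitsBefore b a) := by
  have : hitsBefore b a = {f | hitFrom {b} 0 f < hitFrom {a} 0 f} := by
    ext f
    simp only [hitsBefore, Set.mem_ofPred_eq]
    constructor
    · rintro ⟨t, ht, hv⟩
      have h1 : hitFrom {b} 0 f ≤ t := hitFrom_le_of_mem (by simp) ht
      refine h1.trans_lt (not_le.1 fun h2 => ?_)
      obtain ⟨v, hvt, -, hva⟩ := (hitFrom_le_iff isClosed_singleton).1 h2
      exact hv v hvt hva
    · intro h
      obtain ⟨t, ht⟩ := WithTop.ne_top_iff_exists.1 h.ne_top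
      refine ⟨t, (hitFrom_eq_coe isClosed_singleton ht.symm).2.1, fun v hv hva => ?_⟩
      rw [← ht] at h
      exact absurd (h.trans_le (hitFrom_le_of_mem (by simp) hva))
        (not_lt.2 (WithTop.coe_le_coe.2 hv))
  rw [this]
  exact measurableSet_lt (measurable_hitFrom isClosed_singleton)
    (measurable_hitFrom isClosed_singleton)

/-! ### Diffusions on a filtered space and the strong Markov property -/

/-- `Y` is, on the filtered probability space given by `𝓕` and `P`, a regular diffusion on `I`
with path laws `κ`, started at `y`. -/
structure IsDiffusionFrom {Ω : Type*} {m : MeasurableSpace Ω} (I : Set ℝ)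
    (κ : Kernel ℝ C(ℝ≥0, ℝ)) (𝓕 : Filtration ℝ≥0 m) (P : Measure Ω) (Y : Ω → C(ℝ≥0, ℝ))
    (y : ℝ) : Prop where
  diffusion : IsRegularDiffusion I κ
  prob : IsProbabilityMeasure P
  start_mem : y ∈ I
  adapted : Adapted 𝓕 (fun t ω => Y ω t)
  start : ∀ᵐ ω ∂P, Y ω 0 = y
  markov : IsStrongMarkov κ 𝓕 P Y

/-- The coordinate process under `κ z` is an instance of the general setting, so facts about `Y`
also apply to the path laws themselves. -/
theorem IsRegularDiffusion.isDiffusionFrom {I : Set ℝ} {κ : Kernel ℝ C(ℝ≥0, ℝ)}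
    (hκ : IsRegularDiffusion I κ) {z : ℝ} (hz : z ∈ I) :
    IsDiffusionFrom I κ pathFiltration (κ z) id z :=
  ⟨hκ, hκ.isProbabilityMeasure z hz, hz, adapted_pathFiltration, hκ.start z hz,
    hκ.strongMarkov z hz⟩

theorem measurable_toPath {Ω : Type*} {m : MeasurableSpace Ω} {Y : Ω → C(ℝ≥0, ℝ)}
    (h : ∀ t, Measurable fun ω => Y ω t) : Measurable Y :=
  measurable_comap_iff.2 (measurable_pi_iff.2 h)

@[simp]
theorem shiftPath_zero (f : C(ℝ≥0, ℝ)) : shiftPath 0 f = f := by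
  ext t; simp [shiftPath]

@[simp]
theorem shiftPath_apply (s u : ℝ≥0) (f : C(ℝ≥0, ℝ)) : shiftPath s f u = f (s + u) := rfl

namespace IsDiffusionFrom

variable {Ω : Type*} {m : MeasurableSpace Ω} {I : Set ℝ} {κ : Kernel ℝ C(ℝ≥0, ℝ)}
  {𝓕 : Filtration ℝ≥0 m} {P : Measure Ω} {Y : Ω → C(ℝ≥0, ℝ)} {y : ℝ}

theorem measurable_eval (h : IsDiffusionFrom I κ 𝓕 P Y y) (t : ℝ≥0) :
    Measurable fun ω => Y ω t := (h.adapted t).mono (𝓕.le t) le_rfl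

theorem measurable (h : IsDiffusionFrom I κ 𝓕 P Y y) : Measurable Y :=
  measurable_toPath h.measurable_eval

/-- This is the strong Markov property at the constant time `0`. -/
theorem map_eq (h : IsDiffusionFrom I κ 𝓕 P Y y) : P.map Y = κ y := by
  have := h.prob
  ext Γ hΓ
  rw [Measure.map_apply h.measurable hΓ]
  have h0 : ((0 : ℝ≥0) : WithTop ℝ≥0).untopA = 0 := rfl
  have := h.markov (fun _ => (0 : ℝ≥0)) (isStoppingTime_const 𝓕 0) Set.univ MeasurableSet.univ
    (by intro ω _; simp) Γ hΓ
  simp only [Set.univ_inter, h0, shiftPath_zero, Measure.restrict_univ] at this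
  rw [show Y ⁻¹' Γ = {ω | Y ω ∈ Γ} from rfl, this]
  rw [lintegral_congr_ae (g := fun _ => κ y Γ)]
  · simp
  · filter_upwards [h.start] with ω hω
    rw [hω]

theorem ae_path (h : IsDiffusionFrom I κ 𝓕 P Y y) {p : C(ℝ≥0, ℝ) → Prop}
    (hp : ∀ᵐ f ∂(κ y), p f) : ∀ᵐ ω ∂P, p (Y ω) := by
  rw [← h.map_eq] at hp
  exact ae_of_ae_map h.measurable.aemeasurable hp

theorem ae_mem (h : IsDiffusionFrom I κ 𝓕 P Y y) : ∀ᵐ ω ∂P, ∀ t, Y ω t ∈ I :=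
  h.ae_path (h.diffusion.mem_state y h.start_mem)

theorem isStronglyProgressive (h : IsDiffusionFrom I κ 𝓕 P Y y) :
    IsStronglyProgressive 𝓕 (fun t ω => Y ω t) := by
  have : StronglyAdapted 𝓕 (fun t ω => Y ω t) := fun t => (h.adapted t).stronglyMeasurable
  exact this.isStronglyProgressive_of_continuous fun ω => (Y ω).continuous

theorem measurableSet_exists_eq (h : IsDiffusionFrom I κ 𝓕 P Y y) {τ : Ω → WithTop ℝ≥0}
    (hτ : IsStoppingTime 𝓕 τ) {B : Set ℝ} (hB : MeasurableSet B) :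
    MeasurableSet[hτ.measurableSpace] {ω | ∃ t : ℝ≥0, τ ω = t ∧ Y ω t ∈ B} := by
  have h1 := measurable_stoppedValue h.isStronglyProgressive hτ hB
  have h2 : MeasurableSet[hτ.measurableSpace] {ω | τ ω ≠ ⊤} :=
    ((measurableSet_singleton _).preimage hτ.measurable).compl
  convert! h2.inter h1 using 1
  ext ω
  simp only [Set.mem_ofPred_eq, Set.mem_inter_iff, Set.mem_preimage, stoppedValue]
  constructor
  · rintro ⟨t, ht, hB⟩
    simp [ht, hB]
  · rintro ⟨h1, h2⟩
    obtain ⟨t, ht⟩ := WithTop.ne_top_iff_exists.1 h1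
    refine ⟨t, ht.symm, ?_⟩
    simpa [← ht] using h2

/-- If the path after `τ` is, from the position at time `τ`, in `Γ` with probability at most `c`,
then this bounds the joint probability with an event `A` prior to `τ`. -/
theorem measure_shift_le (h : IsDiffusionFrom I κ 𝓕 P Y y) {τ : Ω → WithTop ℝ≥0}
    (hτ : IsStoppingTime 𝓕 τ) {A : Set Ω} (hA : MeasurableSet[hτ.measurableSpace] A)
    (hfin : ∀ ω ∈ A, τ ω ≠ ⊤) {Γ : Set C(ℝ≥0, ℝ)} (hΓ : MeasurableSet Γ) {c : ℝ≥0∞}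
    (hc : ∀ᵐ ω ∂P, ω ∈ A → ∀ t : ℝ≥0, τ ω = t → κ (Y ω t) Γ ≤ c) :
    P {ω | ω ∈ A ∧ ∃ t : ℝ≥0, τ ω = t ∧ shiftPath t (Y ω) ∈ Γ} ≤ c * P A := by
  have h1 := h.markov τ hτ A hA hfin Γ hΓ
  have h2 : {ω | ω ∈ A ∧ ∃ t : ℝ≥0, τ ω = t ∧ shiftPath t (Y ω) ∈ Γ} =
      A ∩ {ω | shiftPath (τ ω).untopA (Y ω) ∈ Γ} := by
    ext ω
    simp only [Set.mem_ofPred_eq, Set.mem_inter_iff]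
    refine and_congr_right fun hω => ?_
    obtain ⟨t, ht⟩ := WithTop.ne_top_iff_exists.1 (hfin ω hω)
    simp [← ht]
  rw [h2, h1]
  have hA' : MeasurableSet A := hτ.measurableSpace_le _ hA
  calc ∫⁻ ω in A, κ (Y ω (τ ω).untopA) Γ ∂P ≤ ∫⁻ _ in A, c ∂P := by
        refine lintegral_mono_ae ?_
        rw [ae_restrict_iff' hA']
        filter_upwards [hc] with ω hω hA
        obtain ⟨t, ht⟩ := WithTop.ne_top_iff_exists.1 (hfin ω hA)
        simpa [← ht] using hω hA t ht.symm
    _ = c * P A := by simp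

/-- On the event that `Y_τ = x`, the integrand in the strong Markov identity is constant, so past
and future factor. -/
theorem measure_shift_eq (h : IsDiffusionFrom I κ 𝓕 P Y y) {τ : Ω → WithTop ℝ≥0}
    (hτ : IsStoppingTime 𝓕 τ) (x : ℝ) {Γ : Set C(ℝ≥0, ℝ)} (hΓ : MeasurableSet Γ) :
    P {ω | ∃ t : ℝ≥0, τ ω = t ∧ Y ω t = x ∧ shiftPath t (Y ω) ∈ Γ} =
      P {ω | ∃ t : ℝ≥0, τ ω = t ∧ Y ω t = x} * κ x Γ := by
  have hA := h.measurableSet_exists_eq hτ (measurableSet_singleton x)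
  have hfin : {ω | ∃ t : ℝ≥0, τ ω = t ∧ Y ω t ∈ ({x} : Set ℝ)} ⊆ {ω | τ ω ≠ ⊤} := by
    rintro ω ⟨t, ht, -⟩
    simp [ht]
  have h1 := h.markov τ hτ _ hA hfin Γ hΓ
  simp only [Set.mem_singleton_iff] at hA h1
  have h2 : {ω | ∃ t : ℝ≥0, τ ω = t ∧ Y ω t = x ∧ shiftPath t (Y ω) ∈ Γ} =
      {ω | ∃ t : ℝ≥0, τ ω = t ∧ Y ω t = x} ∩ {ω | shiftPath (τ ω).untopA (Y ω) ∈ Γ} := by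
    ext ω
    simp only [Set.mem_ofPred_eq, Set.mem_inter_iff]
    constructor
    · rintro ⟨t, ht, hx, hs⟩
      exact ⟨⟨t, ht, hx⟩, by simpa [ht] using hs⟩
    · rintro ⟨⟨t, ht, hx⟩, hs⟩
      exact ⟨t, ht, hx, by simpa [ht] using hs⟩
  rw [h2, h1, mul_comm, ← setLIntegral_const]
  refine setLIntegral_congr_fun (hτ.measurableSpace_le _ hA) ?_
  rintro ω ⟨t, ht, hx⟩
  simp [ht, hx]

end IsDiffusionFrom

/-! ### Exit from compact intervals and positivity of hitting probabilities -/

theorem isClosed_pair (a b : ℝ) : IsClosed ({a, b} : Set ℝ) := (Set.toFinite _).isClosed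

theorem exists_hitFrom_eq_coe_iff_hitsBefore {x a : ℝ} (hxa : x ≠ a) (f : C(ℝ≥0, ℝ)) :
    (∃ t : ℝ≥0, hitFrom {x, a} 0 f = t ∧ f t = x) ↔ f ∈ hitsBefore x a := by
  constructor
  · rintro ⟨t, ht, hx⟩
    obtain ⟨-, -, hmin⟩ := hitFrom_eq_coe (isClosed_pair x a) ht
    refine ⟨t, hx, fun v hv hva => ?_⟩
    have := hmin v (by simp) (by simp [hva])
    obtain rfl := le_antisymm hv this
    exact hxa (hx.symm.trans hva)
  · rintro ⟨T, hT, hTa⟩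
    obtain ⟨t, ht, -, hmem, hmin⟩ := exists_hitFrom_eq (isClosed_pair x a) (u := 0) (f := f)
      ⟨T, by simp, by simp [hT]⟩
    have htT : t ≤ T := hmin T (by simp) (by simp [hT])
    refine ⟨t, ht, ?_⟩
    rcases hmem with h | h
    · exact h
    · exact absurd h (hTa t htT)

theorem mem_uIcc_of_avoids {a b : ℝ} {f : C(ℝ≥0, ℝ)} (h0 : f 0 ∈ Set.uIcc a b) {t : ℝ≥0}
    (h : ∀ v ≤ t, f v ∉ ({a, b} : Set ℝ)) : f t ∈ Set.uIcc a b := by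
  by_contra hn
  have key : a ∈ Set.uIcc (f 0) (f t) ∨ b ∈ Set.uIcc (f 0) (f t) := by
    simp only [Set.mem_uIcc] at *
    grind
  rcases key with hk | hk <;>
  · obtain ⟨v, -, hvt, hv⟩ := exists_mem_of_mem_uIcc f (zero_le (a := t)) hk
    exact h v hvt (by simp [hv])

namespace IsRegularDiffusion

variable {I : Set ℝ} {κ : Kernel ℝ C(ℝ≥0, ℝ)}

/-- A continuous path from `z` to `b` passes through `x`, and the diffusion restarts there. This
gives a lower bound for hitting `b` that is uniform over a compact interval. -/
theorem measure_hits_le (hκ : IsRegularDiffusion I κ) {z x b : ℝ} (hz : z ∈ I)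
    (hx : x ∈ Set.uIcc z b) : κ z {f | ∃ t, f t = b} ≤ κ x {f | ∃ t, f t = b} := by
  have hd := hκ.isDiffusionFrom hz
  have := hd.prob
  have hΓ : MeasurableSet {f : C(ℝ≥0, ℝ) | ∃ t, f t = b} :=
    measurableSet_exists_mem (isClosed_singleton (x := b))
  have hτ := (isClosed_singleton (x := x)).isStoppingTime_hitFrom hd.adapted
    (isStoppingTime_const pathFiltration 0)
  have h1 := hd.measure_shift_eq hτ x hΓ
  calc κ z {f | ∃ t, f t = b} ≤ κ z {f | ∃ t : ℝ≥0, hitFrom {x} (0 : ℝ≥0) (id f) = t ∧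
        (id f : C(ℝ≥0, ℝ)) t = x ∧ shiftPath t (id f) ∈ {f : C(ℝ≥0, ℝ) | ∃ t, f t = b}} := by
        refine measure_mono_ae ?_
        filter_upwards [hκ.start z hz] with f hf
        rintro ⟨T, hT⟩
        rw [← hf, ← hT] at hx
        obtain ⟨v, -, hvT, hv⟩ := exists_mem_of_mem_uIcc f (zero_le (a := T)) hx
        obtain ⟨t, ht, -, htx, hmin⟩ := exists_hitFrom_eq (isClosed_singleton (x := x))
          (u := (0 : ℝ≥0)) (f := f) ⟨v, by simp, hv⟩
        have htT : t ≤ T := (hmin v (by simp) hv).trans hvT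
        exact ⟨t, ht, htx, T - t, by simp [add_tsub_cancel_of_le htT, hT]⟩
    _ = _ := h1
    _ ≤ 1 * κ x {f | ∃ t, f t = b} := by gcongr; exact prob_le_one
    _ = _ := one_mul _

/-- The diffusion leaves a compact subinterval of the interior in finite time. -/
theorem ae_exit (hκ : IsRegularDiffusion I κ) {a b : ℝ} (hab : Set.uIcc a b ⊆ interior I) {z : ℝ}
    (hz : z ∈ Set.uIcc a b) : ∀ᵐ f ∂(κ z), ∃ t, f t ∈ ({a, b} : Set ℝ) := by
  set N : Set C(ℝ≥0, ℝ) := {f | ∃ t, f t ∈ ({a, b} : Set ℝ)}ᶜ with hN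
  have hNm : MeasurableSet N := (measurableSet_exists_mem (isClosed_pair a b)).compl
  have hI : ∀ {w}, w ∈ Set.uIcc a b → w ∈ I := fun hw => interior_subset (hab hw)
  -- Of all points between `a` and `b`, the start `a` has the least chance of reaching `b`; hence
  -- `c` bounds the probability of no exit from every one of them.
  set c : ℝ≥0∞ := 1 - κ a {f | ∃ t, f t = b} with hc
  have hpos : 0 < κ a {f | ∃ t, f t = b} :=
    hκ.regular a (hab Set.left_mem_uIcc) b (hI Set.right_mem_uIcc)
  have hc1 : c < 1 := ENNReal.sub_lt_self ENNReal.one_ne_top one_ne_zero hpos.ne'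
  have hbound : ∀ w ∈ Set.uIcc a b, κ w N ≤ c := by
    intro w hw
    have := hκ.isProbabilityMeasure w (hI hw)
    have hm : MeasurableSet {f : C(ℝ≥0, ℝ) | ∃ t, f t = b} :=
      measurableSet_exists_mem (isClosed_singleton (x := b))
    calc κ w N ≤ κ w {f | ∃ t, f t = b}ᶜ := by
          refine measure_mono (Set.compl_subset_compl.2 ?_)
          rintro f ⟨t, ht⟩
          exact ⟨t, by simp [ht]⟩
      _ = 1 - κ w {f | ∃ t, f t = b} := prob_compl_eq_one_sub hm
      _ ≤ c := tsub_le_tsub_left (hκ.measure_hits_le (hI Set.left_mem_uIcc) hw) _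
  have hd := hκ.isDiffusionFrom (hI hz)
  have := hd.prob
  set A : ℕ → Set C(ℝ≥0, ℝ) := fun n => {f | ∀ v ≤ (n : ℝ≥0), f v ∉ ({a, b} : Set ℝ)} with hA
  have hAm : ∀ n, MeasurableSet (A n) := by
    intro n
    convert! (measurableSet_exists_le_mem (isClosed_pair a b) (n : ℝ≥0)).compl using 1
    ext f
    simp [hA]
  -- Restarting at the fixed time `n` costs a factor `c`. As `n → ∞` the events `A n` decrease to
  -- `N`, so `κ z N ≤ c * κ z N` with `c < 1`, which forces a null set.
  have hstep : ∀ n, κ z N ≤ c * κ z (A n) := by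
    intro n
    have hτ := isStoppingTime_const pathFiltration (n : ℝ≥0)
    have hAF : MeasurableSet[hτ.measurableSpace] (A n) := by
      rw [IsStoppingTime.measurableSpace_const]
      have h1 := (((isClosed_pair a b).isStoppingTime_hitFrom hd.adapted
        (isStoppingTime_const pathFiltration 0)).measurableSet_le (n : ℝ≥0)).compl
      convert! h1 using 1
      ext f
      simp only [hA, Set.mem_ofPred_eq, Set.mem_compl_iff]
      rw [hitFrom_le_iff (isClosed_pair a b)]
      simp
    refine le_trans ?_ (hd.measure_shift_le hτ hAF (by simp) hNm (c := c) ?_)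
    · refine measure_mono fun f hf => ⟨fun v _ hv => hf ⟨v, hv⟩, n, rfl, ?_⟩
      rintro ⟨t, ht⟩
      exact hf ⟨n + t, ht⟩
    · filter_upwards [hd.start] with f hf hfA t ht
      obtain rfl : (n : ℝ≥0) = t := WithTop.coe_injective ht
      exact hbound _ (mem_uIcc_of_avoids (f := f) (by rw [show f 0 = z from hf]; exact hz) hfA)
  have hlim : Tendsto (fun n => κ z (A n)) atTop (𝓝 (κ z N)) := by
    have : N = ⋂ n, A n := by
      ext f
      simp only [hN, hA, Set.mem_compl_iff, Set.mem_ofPred_eq, Set.mem_iInter, not_exists]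
      refine ⟨fun h n v _ => h v, fun h v => ?_⟩
      obtain ⟨n, hn⟩ := exists_nat_ge v
      exact h n v hn
    rw [this]
    refine tendsto_measure_iInter_atTop (fun n => (hAm n).nullMeasurableSet) ?_
      ⟨0, measure_ne_top _ _⟩
    intro n k hnk f hf v hv
    exact hf v (hv.trans (by exact_mod_cast hnk))
  have hle : κ z N ≤ c * κ z N :=
    ge_of_tendsto' (ENNReal.Tendsto.const_mul hlim (Or.inr hc1.ne_top)) hstep
  have h0 : κ z N = 0 := by
    by_contra hne
    have h1 : c * κ z N < 1 * κ z N :=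
      ENNReal.mul_lt_mul_left hne (measure_ne_top _ _) hc1
    rw [one_mul] at h1
    exact absurd hle (not_le.2 h1)
  rw [ae_iff]
  exact h0

/-- From a point strictly between `a` and `b`, the point `b` is reached before `a` with positive
probability. -/
theorem measure_hitsBefore_pos (hκ : IsRegularDiffusion I κ) {a b c : ℝ}
    (hab : Set.uIcc a b ⊆ interior I) (hc : c ∈ Set.uIcc a b) (hca : c ≠ a) (hcb : c ≠ b) :
    0 < κ c (hitsBefore b a) := by
  have hcI : c ∈ I := interior_subset (hab hc)
  have hd := hκ.isDiffusionFrom hcI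
  have := hd.prob
  by_contra hzero
  have hzero : κ c (hitsBefore b a) = 0 := by simpa using hzero
  -- `R` is the first return to `c` after a visit to `a`. If `b` were almost never reached before
  -- `a`, every path to `b` would first pass `a` and then `c` again, thus only after time `R`.
  set R : C(ℝ≥0, ℝ) → WithTop ℝ≥0 := fun f => hitFrom {c} (hitFrom {a} (0 : ℝ≥0) f) f with hR
  have hRs : IsStoppingTime pathFiltration R :=
    (isClosed_singleton (x := c)).isStoppingTime_hitFrom hd.adapted
      ((isClosed_singleton (x := a)).isStoppingTime_hitFrom hd.adapted
        (isStoppingTime_const pathFiltration 0))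
  have hRpos : ∀ f : C(ℝ≥0, ℝ), f 0 = c → ¬ R f ≤ (0 : ℝ≥0) := by
    intro f hf hle
    have h1 := (le_hitFrom {c} (hitFrom {a} (0 : ℝ≥0) f) f).trans hle
    obtain ⟨v, hv, -, hva⟩ := (hitFrom_le_iff isClosed_singleton).1 h1
    obtain rfl : v = 0 := le_antisymm hv zero_le
    exact hca (hf.symm.trans hva)
  -- `R` is almost surely positive because `c ≠ a`, so a short return cannot have probability one
  -- for every `δ`.
  have hδ : ∃ δ : ℝ≥0, 0 < δ ∧ κ c {f | R f ≤ δ} < 1 := by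
    by_contra hno
    push Not at hno
    set B : ℕ → Set C(ℝ≥0, ℝ) := fun n => {f | R f ≤ ((1 / ((n : ℝ≥0) + 1) : ℝ≥0) : WithTop ℝ≥0)}
    have hBm : ∀ n, MeasurableSet (B n) := fun n => hRs.measurable' measurableSet_Iic
    have hlim : Tendsto (fun n => κ c (B n)) atTop (𝓝 (κ c (⋂ n, B n))) := by
      refine tendsto_measure_iInter_atTop (fun n => (hBm n).nullMeasurableSet) ?_
        ⟨0, measure_ne_top _ _⟩
      intro n k hnk f hf
      refine le_trans (show R f ≤ _ from hf) (WithTop.coe_le_coe.2 ?_)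
      exact one_div_le_one_div_of_le (by positivity) (by gcongr)
    have hnull : κ c (⋂ n, B n) = 0 := by
      have : ∀ᵐ f ∂(κ c), f ∉ ⋂ n, B n := by
        filter_upwards [hκ.start c hcI] with f hf hB
        refine hRpos f hf ?_
        have hB' : ∀ n : ℕ, R f ≤ ((1 / ((n : ℝ≥0) + 1) : ℝ≥0) : WithTop ℝ≥0) :=
          fun n => Set.mem_iInter.1 hB n
        refine ge_of_tendsto' (x := atTop) ((WithTop.continuous_coe.tendsto (0 : ℝ≥0)).comp ?_) hB'
        exact tendsto_one_div_add_atTop_nhds_zero_nat (𝕜 := ℝ≥0)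
      exact measure_eq_zero_iff_ae_notMem.2 this
    rw [hnull] at hlim
    exact absurd (ge_of_tendsto' hlim fun n => hno _ (by positivity)) (by simp)
  obtain ⟨δ, hδ0, hδ⟩ := hδ
  set Γ : ℕ → Set C(ℝ≥0, ℝ) := fun j => {f | ∃ v ≤ (j : ℝ≥0) * δ, f v ∈ ({b} : Set ℝ)} with hΓ
  have hΓm : ∀ j, MeasurableSet (Γ j) := fun j =>
    measurableSet_exists_le_mem isClosed_singleton _
  have hex : ∃ j, κ c (Γ j) ≠ 0 := by
    by_contra hno
    push Not at hno
    have hpos := hκ.regular c (hab hc) b (interior_subset (hab Set.right_mem_uIcc))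
    refine hpos.ne' (measure_mono_null ?_ (measure_iUnion_null hno))
    rintro f ⟨t, ht⟩
    obtain ⟨j, hj⟩ := exists_nat_ge (t / δ)
    refine Set.mem_iUnion.2 ⟨j, t, ?_, ht⟩
    rwa [div_le_iff₀ hδ0] at hj
  classical
  -- Within `jδ` the point `b` is almost surely not reached, within `(j+1)δ` it is reached with
  -- positive probability.
  obtain ⟨j, hj1, hj0⟩ : ∃ j, κ c (Γ (j + 1)) ≠ 0 ∧ κ c (Γ j) = 0 := by
    have h0 : κ c (Γ 0) = 0 := by
      have : ∀ᵐ f ∂(κ c), f ∉ Γ 0 := by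
        filter_upwards [hκ.start c hcI] with f hf
        rintro ⟨v, hv, hvb⟩
        obtain rfl : v = 0 := by simpa using hv
        exact hcb (hf.symm.trans hvb)
      simpa [ae_iff] using this
    have hk := Nat.find_spec hex
    obtain ⟨j, hj⟩ := Nat.exists_eq_succ_of_ne_zero
      (show Nat.find hex ≠ 0 from fun h => hk (by rw [h]; exact h0))
    refine ⟨j, by rw [hj] at hk; exact hk, ?_⟩
    by_contra hne
    have := Nat.find_min' hex hne
    omega
  have hRc : ∀ f t, R f = (t : ℝ≥0) → f t = c := fun f t ht =>
    (hitFrom_eq_coe isClosed_singleton ht).2.1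
  have hA : MeasurableSet[hRs.measurableSpace] {f | R f ≤ δ} := hRs.measurableSet_le' δ
  have hA' : MeasurableSet[hRs.measurableSpace] {f | R f ≠ ⊤} :=
    ((measurableSet_singleton _).preimage hRs.measurable).compl
  have h1 := hd.measure_shift_le hRs hA
    (fun f (hf : R f ≤ δ) => (hf.trans_lt (WithTop.coe_lt_top δ)).ne) (hΓm (j + 1))
    (c := κ c (Γ (j + 1))) (ae_of_all _ fun f _ t ht => by
      rw [show (id f : C(ℝ≥0, ℝ)) t = c from hRc f t ht])
  have h2 := hd.measure_shift_le hRs hA' (fun f hf => hf) (hΓm j)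
    (c := κ c (Γ j)) (ae_of_all _ fun f _ t ht => by
      rw [show (id f : C(ℝ≥0, ℝ)) t = c from hRc f t ht])
  rw [hj0, zero_mul] at h2
  -- After a return later than `δ` at most `jδ` of time remains, a null event. After an earlier one
  -- the restart contributes the factor `κ c {f | R f ≤ δ} < 1`; the resulting inequality is
  -- impossible.
  have h3 : κ c (Γ (j + 1)) ≤ κ c (Γ (j + 1)) * κ c {f | R f ≤ δ} + 0 := by
    refine le_trans ?_ ((measure_union_le _ _).trans (add_le_add h1 h2))
    refine measure_mono_ae ?_
    have hz : ∀ᵐ f ∂(κ c), f ∉ hitsBefore b a := by simpa [ae_iff] using hzero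
    filter_upwards [hκ.start c hcI, hz] with f hf hfz
    rintro ⟨v, hv, hvb⟩
    have hvb : f v = b := hvb
    obtain ⟨v', hv', hva⟩ : ∃ v' ≤ v, f v' = a := by
      by_contra hno
      push Not at hno
      exact hfz ⟨v, hvb, hno⟩
    rw [← hva, ← hvb] at hc
    obtain ⟨w, hw1, hw2, hw⟩ := exists_mem_of_mem_uIcc f hv' hc
    have hRw : R f ≤ w := hitFrom_le_of_mem
      ((hitFrom_le_of_mem (by simp) hva).trans (WithTop.coe_le_coe.2 hw1)) hw
    obtain ⟨t, ht⟩ := WithTop.ne_top_iff_exists.1 (hRw.trans_lt (WithTop.coe_lt_top w)).ne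
    have htv : t ≤ v := by
      rw [← ht] at hRw
      exact (WithTop.coe_le_coe.1 hRw).trans hw2
    by_cases htδ : t ≤ δ
    · left
      refine ⟨show R f ≤ δ by rw [← ht]; exact WithTop.coe_le_coe.2 htδ, t, ht.symm, v - t,
        tsub_le_self.trans hv, ?_⟩
      simp [add_tsub_cancel_of_le htv, hvb]
    · right
      refine ⟨show R f ≠ ⊤ by rw [← ht]; exact WithTop.coe_ne_top, t, ht.symm, v - t, ?_, ?_⟩
      · rw [tsub_le_iff_left]
        refine hv.trans ?_
        push_cast
        rw [add_mul, one_mul, add_comm]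
        gcongr
        exact (not_le.1 htδ).le
      · simp [add_tsub_cancel_of_le htv, hvb]
  rw [add_zero] at h3
  have h4 : κ c (Γ (j + 1)) * κ c {f | R f ≤ δ} < κ c (Γ (j + 1)) * 1 :=
    ENNReal.mul_lt_mul_right hj1 (measure_ne_top _ _) hδ
  rw [mul_one] at h4
  exact absurd h3 (not_le.2 h4)

end IsRegularDiffusion

/-! ### Hitting probabilities as a scale function -/

/-- The probability that a diffusion started at `z` reaches `b`, and does so before `a`. -/
noncomputable def hitProb (κ : Kernel ℝ C(ℝ≥0, ℝ)) (b a z : ℝ) : ℝ := (κ z).real (hitsBefore b a)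

/-- Optional stopping for the scale function: neither `l` nor `r` has been visited before `σ`, so
the order in which they are reached is decided by the path after `σ`, which restarts from `Y_σ`. -/
theorem IsDiffusionFrom.hitProb_eq_sum {Ω : Type*} {m : MeasurableSpace Ω} {I : Set ℝ}
    {κ : Kernel ℝ C(ℝ≥0, ℝ)} {𝓕 : Filtration ℝ≥0 m} {P : Measure Ω} {Y : Ω → C(ℝ≥0, ℝ)} {y : ℝ}
    (h : IsDiffusionFrom I κ 𝓕 P Y y) {σ : Ω → WithTop ℝ≥0} (hσ : IsStoppingTime 𝓕 σ)
    {l r : ℝ} {G : Finset ℝ}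
    (hG : ∀ᵐ ω ∂P, ∃ t : ℝ≥0, σ ω = t ∧ Y ω t ∈ G ∧ ∀ v < t, Y ω v ≠ l ∧ Y ω v ≠ r) :
    hitProb κ r l y =
      ∑ x ∈ G, P.real {ω | ∃ t : ℝ≥0, σ ω = t ∧ Y ω t = x} * hitProb κ r l x := by
  have := h.prob
  have hΓ := measurableSet_hitsBefore r l
  set E : ℝ → Set Ω := fun x =>
    {ω | ∃ t : ℝ≥0, σ ω = t ∧ Y ω t = x ∧ shiftPath t (Y ω) ∈ hitsBefore r l} with hE
  have hEm : ∀ x, MeasurableSet (E x) := by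
    intro x
    have h1 : MeasurableSet {ω | ∃ t : ℝ≥0, σ ω = t ∧ Y ω t ∈ ({x} : Set ℝ)} :=
      hσ.measurableSpace_le _ (h.measurableSet_exists_eq hσ (measurableSet_singleton x))
    have h2 : Measurable fun ω => shiftPath (σ ω).untopA (Y ω) := by
      refine measurable_toPath fun t => ?_
      have hc : Measurable (Function.uncurry fun (ω : Ω) (s : ℝ≥0) => Y ω s) :=
        measurable_uncurry_of_continuous_of_measurable (u := fun s ω => Y ω s)
          (fun ω => (Y ω).continuous) h.measurable_eval |>.comp measurable_swap
      exact hc.comp (measurable_id.prodMk ((hσ.measurable'.untopA).add_const t))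
    convert! h1.inter (h2 hΓ) using 1
    ext ω
    simp only [hE, Set.mem_ofPred_eq, Set.mem_singleton_iff, Set.mem_inter_iff, Set.mem_preimage]
    constructor
    · rintro ⟨t, ht, hx, hs⟩
      exact ⟨⟨t, ht, hx⟩, by simpa [ht] using hs⟩
    · rintro ⟨⟨t, ht, hx⟩, hs⟩
      exact ⟨t, ht, hx, by simpa [ht] using hs⟩
  have hdisj : Set.PairwiseDisjoint (G : Set ℝ) E := by
    intro x _ x' _ hne
    refine Set.disjoint_left.2 ?_
    rintro ω ⟨t, ht, hx, -⟩ ⟨t', ht', hx', -⟩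
    obtain rfl : t = t' := WithTop.coe_injective (ht.symm.trans ht')
    exact hne (hx.symm.trans hx')
  have hae : Y ⁻¹' hitsBefore r l =ᵐ[P] ⋃ x ∈ G, E x := by
    filter_upwards [hG] with ω hω
    obtain ⟨t, ht, hmem, hv⟩ := hω
    refine propext ?_
    change Y ω ∈ hitsBefore r l ↔ ω ∈ ⋃ x ∈ G, E x
    simp only [Set.mem_iUnion, exists_prop]
    constructor
    · rintro ⟨T, hT, hTl⟩
      have htT : t ≤ T := not_lt.1 fun hlt => (hv T hlt).2 hT
      refine ⟨Y ω t, hmem, t, ht, rfl, T - t, by simp [add_tsub_cancel_of_le htT, hT], ?_⟩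
      intro w hw
      exact hTl (t + w) (by rwa [le_tsub_iff_left htT] at hw)
    · rintro ⟨x, -, t', ht', hx, T, hT, hTl⟩
      obtain rfl : t = t' := WithTop.coe_injective (ht.symm.trans ht')
      refine ⟨t + T, hT, fun v hvT => ?_⟩
      rcases lt_or_ge v t with hlt | hge
      · exact (hv v hlt).1
      · have := hTl (v - t) (by rwa [tsub_le_iff_left])
        simpa [add_tsub_cancel_of_le hge] using this
  have h1 : hitProb κ r l y = P.real (Y ⁻¹' hitsBefore r l) := by
    rw [hitProb, ← h.map_eq, map_measureReal_apply h.measurable hΓ]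
  rw [h1, measureReal_congr hae, measureReal_biUnion_finset hdisj fun x _ => hEm x]
  refine Finset.sum_congr rfl fun x _ => ?_
  simp only [measureReal_def, hitProb, hE]
  rw [h.measure_shift_eq hσ x hΓ, ENNReal.toReal_mul]

namespace IsRegularDiffusion

variable {I : Set ℝ} {κ : Kernel ℝ C(ℝ≥0, ℝ)}

theorem hitProb_self (hκ : IsRegularDiffusion I κ) {a b : ℝ} (hb : b ∈ I) (hab : a ≠ b) :
    hitProb κ b a b = 1 := by
  have := hκ.isProbabilityMeasure b hb
  have h1 : hitsBefore b a =ᵐ[κ b] (Set.univ : Set C(ℝ≥0, ℝ)) := by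
    filter_upwards [hκ.start b hb] with f hf
    refine eq_true (show f ∈ hitsBefore b a from ⟨0, hf, fun v hv => ?_⟩)
    obtain rfl : v = 0 := le_antisymm hv zero_le
    rw [hf]
    exact hab.symm
  rw [hitProb, measureReal_congr h1, probReal_univ]

/-- To reach `b` before `a`, a path from `z` must first reach the intermediate point `x` before `a`,
and then succeed from `x`. -/
theorem hitProb_mul (hκ : IsRegularDiffusion I κ) {z x a b : ℝ} (hz : z ∈ I)
    (hx : x ∈ Set.uIcc z b) (hxa : x ≠ a) :
    hitProb κ b a z = hitProb κ x a z * hitProb κ b a x := by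
  have hd := hκ.isDiffusionFrom hz
  have hτ := (isClosed_pair x a).isStoppingTime_hitFrom hd.adapted
    (isStoppingTime_const pathFiltration 0)
  have h1 := hd.measure_shift_eq hτ x (measurableSet_hitsBefore b a)
  have h2 : {f : C(ℝ≥0, ℝ) | ∃ t : ℝ≥0, hitFrom {x, a} (0 : ℝ≥0) (id f) = t ∧
      (id f : C(ℝ≥0, ℝ)) t = x} = hitsBefore x a :=
    Set.ext fun f => exists_hitFrom_eq_coe_iff_hitsBefore hxa f
  rw [h2] at h1
  simp only [hitProb, measureReal_def]
  rw [← ENNReal.toReal_mul, ← h1]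
  congr 1
  refine measure_congr ?_
  filter_upwards [hκ.start z hz] with f hf
  refine propext ?_
  change f ∈ hitsBefore b a ↔ ∃ t : ℝ≥0, hitFrom {x, a} (0 : ℝ≥0) f = t ∧ f t = x ∧
    shiftPath t f ∈ hitsBefore b a
  constructor
  · rintro ⟨T, hT, hTa⟩
    rw [← hf, ← hT] at hx
    obtain ⟨v, -, hvT, hv⟩ := exists_mem_of_mem_uIcc f (zero_le (a := T)) hx
    obtain ⟨t, ht, htx⟩ := (exists_hitFrom_eq_coe_iff_hitsBefore hxa f).2
      ⟨v, hv, fun w hw => hTa w (hw.trans hvT)⟩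
    have htT : t ≤ T := ((hitFrom_eq_coe (isClosed_pair x a) ht).2.2 v (by simp)
      (by simp [hv])).trans hvT
    refine ⟨t, ht, htx, T - t, by simp [add_tsub_cancel_of_le htT, hT], fun w hw => ?_⟩
    exact hTa (t + w) (by rwa [le_tsub_iff_left htT] at hw)
  · rintro ⟨t, ht, htx, T, hT, hTa⟩
    refine ⟨t + T, hT, fun v hvT => ?_⟩
    rcases lt_or_ge v t with hlt | hge
    · intro hva
      exact absurd ((hitFrom_eq_coe (isClosed_pair x a) ht).2.2 v (by simp)
        (by simp [hva])) (not_le.2 hlt)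
    · have := hTa (v - t) (by rwa [tsub_le_iff_left])
      simpa [add_tsub_cancel_of_le hge] using this

theorem ae_mem_hitsBefore_or (hκ : IsRegularDiffusion I κ) {a b : ℝ}
    (hab : Set.uIcc a b ⊆ interior I) (hne : a ≠ b) {z : ℝ} (hz : z ∈ Set.uIcc a b) :
    ∀ᵐ f ∂(κ z), f ∈ hitsBefore a b ∨ f ∈ hitsBefore b a := by
  filter_upwards [hκ.ae_exit hab hz] with f hf
  obtain ⟨T, hT⟩ := hf
  obtain ⟨t, ht, -, hmem, hmin⟩ := exists_hitFrom_eq (isClosed_pair a b) (u := 0) (f := f)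
    ⟨T, by simp, hT⟩
  rcases hmem with h | h
  · exact Or.inl ((exists_hitFrom_eq_coe_iff_hitsBefore hne f).1 ⟨t, ht, h⟩)
  · exact Or.inr ((exists_hitFrom_eq_coe_iff_hitsBefore hne.symm f).1
      ⟨t, by rw [Set.pair_comm]; exact ht, h⟩)

theorem disjoint_hitsBefore (a b : ℝ) : Disjoint (hitsBefore a b) (hitsBefore b a) := by
  refine Set.disjoint_left.2 ?_
  rintro f ⟨t, ht, h1⟩ ⟨s, hs, h2⟩
  rcases le_total t s with h | h
  · exact h2 t h ht
  · exact h1 s h hs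

theorem hitProb_add_hitProb (hκ : IsRegularDiffusion I κ) {a b : ℝ}
    (hab : Set.uIcc a b ⊆ interior I) (hne : a ≠ b) {z : ℝ} (hz : z ∈ Set.uIcc a b) :
    hitProb κ a b z + hitProb κ b a z = 1 := by
  have := hκ.isProbabilityMeasure z (interior_subset (hab hz))
  simp only [hitProb]
  rw [← measureReal_union (disjoint_hitsBefore a b) (measurableSet_hitsBefore b a)]
  have h1 : (hitsBefore a b ∪ hitsBefore b a : Set C(ℝ≥0, ℝ)) =ᵐ[κ z]
      (Set.univ : Set C(ℝ≥0, ℝ)) := by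
    filter_upwards [hκ.ae_mem_hitsBefore_or hab hne hz] with f hf
    exact eq_true hf
  rw [measureReal_congr h1, probReal_univ]

theorem hitProb_pos (hκ : IsRegularDiffusion I κ) {a b c : ℝ}
    (hab : Set.uIcc a b ⊆ interior I) (hc : c ∈ Set.uIcc a b) (hca : c ≠ a) :
    0 < hitProb κ b a c := by
  have := hκ.isProbabilityMeasure c (interior_subset (hab hc))
  rcases eq_or_ne c b with rfl | hcb
  · rw [hκ.hitProb_self (interior_subset (hab hc)) hca.symm]
    exact one_pos
  · exact ENNReal.toReal_pos (hκ.measure_hitsBefore_pos hab hc hca hcb).ne' (measure_ne_top _ _)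

/-- The indicators converge almost surely. A path that reaches `c` before `a` meets every `x n` on
its way. A path that reaches `a` first has, up to then, a compact range missing `c`, hence missing
`x n` for large `n`. -/
theorem tendsto_hitProb_target (hκ : IsRegularDiffusion I κ) {a c z : ℝ}
    (hac : Set.uIcc a c ⊆ interior I) (hne : a ≠ c) (hz : z ∈ Set.uIcc a c) {x : ℕ → ℝ}
    (hx : ∀ n, x n ∈ Set.uIcc z c) (hlim : Tendsto x atTop (𝓝 c)) :
    Tendsto (fun n => hitProb κ (x n) a z) atTop (𝓝 (hitProb κ c a z)) := by
  have hzI := interior_subset (hac hz)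
  have := hκ.isProbabilityMeasure z hzI
  refine (ENNReal.tendsto_toReal (measure_ne_top _ _)).comp ?_
  refine tendsto_measure_of_ae_tendsto_indicator_of_isFiniteMeasure atTop
    (measurableSet_hitsBefore c a) (fun n => measurableSet_hitsBefore (x n) a) ?_
  filter_upwards [hκ.ae_mem_hitsBefore_or hac hne hz, hκ.start z hzI] with f hf hf0
  rcases hf with hf | hf
  · have hnc : f ∉ hitsBefore c a := Set.disjoint_left.1 (disjoint_hitsBefore a c) hf
    obtain ⟨t, hta, htc⟩ := hf
    have hK : IsClosed (f '' Set.Icc 0 t) := (isCompact_Icc.image f.continuous).isClosed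
    have hcK : c ∈ (f '' Set.Icc 0 t)ᶜ := by
      rintro ⟨v, hv, hvc⟩
      exact htc v hv.2 hvc
    filter_upwards [hlim (hK.isOpen_compl.mem_nhds hcK)] with n hn
    refine iff_of_false ?_ hnc
    rintro ⟨T, hT, hTa⟩
    have hTt : T ≤ t := not_lt.1 fun hlt => hTa t hlt.le hta
    exact hn ⟨T, ⟨zero_le, hTt⟩, hT⟩
  · refine Eventually.of_forall fun n => iff_of_true ?_ hf
    obtain ⟨T, hT, hTa⟩ := hf
    have hxn := hx n
    rw [← hf0, ← hT] at hxn
    obtain ⟨v, -, hvT, hv⟩ := exists_mem_of_mem_uIcc f (zero_le (a := T)) hxn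
    exact ⟨v, hv, fun w hw => hTa w (hw.trans hvT)⟩

/-- Multiplicativity turns continuity in the target into continuity in the starting point, by
dividing by `hitProb κ (x n) a z`. Only approach to `c` from the side of `a` is covered. -/
theorem tendsto_hitProb (hκ : IsRegularDiffusion I κ) {a b c z : ℝ}
    (hab : Set.uIcc a b ⊆ interior I) (hne : a ≠ b) (hc : c ∈ Set.uIcc a b)
    (hz : z ∈ Set.uIcc a c) (hza : z ≠ a) {x : ℕ → ℝ}
    (hx : ∀ n, x n ∈ Set.uIcc z c) (hlim : Tendsto x atTop (𝓝 c)) :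
    Tendsto (fun n => hitProb κ b a (x n)) atTop (𝓝 (hitProb κ b a c)) := by
  have hac : Set.uIcc a c ⊆ interior I := (Set.uIcc_subset_uIcc_left hc).trans hab
  have hca : c ≠ a := by
    rintro rfl
    simp at hz
    exact hza hz
  have hxa : ∀ n, x n ≠ a := by
    intro n
    have := hx n
    simp only [Set.mem_uIcc] at *
    grind
  have hz' : z ∈ Set.uIcc a b := by
    simp only [Set.mem_uIcc] at *
    grind
  have hxb : ∀ n, x n ∈ Set.uIcc z b := by
    intro n
    have := hx n
    simp only [Set.mem_uIcc] at *
    grind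
  have hcb : c ∈ Set.uIcc z b := by
    simp only [Set.mem_uIcc] at *
    grind
  have hzI := interior_subset (hac hz)
  have h1 := hκ.tendsto_hitProb_target hac hca.symm hz hx hlim
  have hpos := hκ.hitProb_pos hac hz hza
  have h2 : ∀ᶠ n in atTop, hitProb κ b a z / hitProb κ (x n) a z = hitProb κ b a (x n) := by
    filter_upwards [h1.eventually (lt_mem_nhds hpos)] with n hn
    rw [hκ.hitProb_mul hzI (hxb n) (hxa n)]
    field_simp
  have h3 : hitProb κ b a z / hitProb κ c a z = hitProb κ b a c := by
    rw [hκ.hitProb_mul hzI hcb hca]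
    field_simp
  rw [← h3]
  exact (tendsto_const_nhds.div h1 hpos.ne').congr' h2

section Interval

variable {l r : ℝ}

/-- Optional stopping at the exit from `(a, b)`. -/
theorem hitProb_eq_combination (hκ : IsRegularDiffusion I κ) (hlr : Set.Icc l r ⊆ interior I)
    {a b c : ℝ} (hla : l ≤ a) (hac : a < c) (hcb : c < b) (hbr : b ≤ r) :
    hitProb κ r l c = hitProb κ a b c * hitProb κ r l a + hitProb κ b a c * hitProb κ r l b := by
  have hab : a < b := hac.trans hcb
  have hcI : c ∈ I := interior_subset (hlr ⟨by linarith, by linarith⟩)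
  have hsub : Set.uIcc a b ⊆ interior I := by
    rw [Set.uIcc_of_le hab.le]
    exact (Set.Icc_subset_Icc hla hbr).trans hlr
  have hcab : c ∈ Set.uIcc a b := by
    rw [Set.uIcc_of_le hab.le]
    exact ⟨hac.le, hcb.le⟩
  have hd := hκ.isDiffusionFrom hcI
  have hτ := (isClosed_pair a b).isStoppingTime_hitFrom hd.adapted
    (isStoppingTime_const pathFiltration 0)
  have h1 := hd.hitProb_eq_sum hτ (l := l) (r := r) (G := {a, b}) ?_
  · have h2 : {f : C(ℝ≥0, ℝ) | ∃ t : ℝ≥0, hitFrom {a, b} (0 : ℝ≥0) (id f) = t ∧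
        (id f : C(ℝ≥0, ℝ)) t = a} = hitsBefore a b :=
      Set.ext fun f => exists_hitFrom_eq_coe_iff_hitsBefore hab.ne f
    have h3 : {f : C(ℝ≥0, ℝ) | ∃ t : ℝ≥0, hitFrom {a, b} (0 : ℝ≥0) (id f) = t ∧
        (id f : C(ℝ≥0, ℝ)) t = b} = hitsBefore b a := by
      rw [Set.pair_comm]
      exact Set.ext fun f => exists_hitFrom_eq_coe_iff_hitsBefore hab.ne' f
    rw [Finset.sum_pair hab.ne, h2, h3] at h1
    exact h1
  · filter_upwards [hκ.ae_exit hsub hcab, hκ.start c hcI] with f hf hf0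
    obtain ⟨T, hT⟩ := hf
    obtain ⟨t, ht, -, hmem, hmin⟩ := exists_hitFrom_eq (isClosed_pair a b) (u := (0 : ℝ≥0))
      (f := f) ⟨T, by simp, hT⟩
    refine ⟨t, ht, by simpa using hmem, fun v hv => ?_⟩
    have hav : ∀ w ≤ v, f w ∉ ({a, b} : Set ℝ) := fun w hw hwm =>
      absurd (hmin w (by simp) hwm) (not_le.2 (hw.trans_lt hv))
    have h2 := mem_uIcc_of_avoids (f := f) (by rw [hf0]; exact hcab) hav
    have h3 := hav v le_rfl
    rw [Set.uIcc_of_le hab.le] at h2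
    simp only [Set.mem_insert_iff, Set.mem_singleton_iff, not_or] at h3
    have h4 := lt_of_le_of_ne h2.1 (Ne.symm h3.1)
    have h5 := lt_of_le_of_ne h2.2 h3.2
    exact ⟨(hla.trans_lt h4).ne', (h5.trans_le hbr).ne⟩

theorem strictMonoOn_hitProb (hκ : IsRegularDiffusion I κ) (hlr : Set.Icc l r ⊆ interior I) :
    StrictMonoOn (hitProb κ r l) (Set.Icc l r) := by
  intro a ha c hc hac
  have hltr : l < r := (ha.1.trans_lt hac).trans_le hc.2
  have hsub : Set.uIcc l r ⊆ interior I := by rwa [Set.uIcc_of_le hltr.le]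
  have hau : a ∈ Set.uIcc l r := by rwa [Set.uIcc_of_le hltr.le]
  have har : a < r := hac.trans_le hc.2
  have h1 : hitProb κ r l a < 1 := by
    have h2 := hκ.hitProb_add_hitProb hsub hltr.ne hau
    have h3 := hκ.hitProb_pos (a := r) (b := l) (c := a) (by rwa [Set.uIcc_comm])
      (by rwa [Set.uIcc_comm]) har.ne
    linarith
  have hrI : r ∈ I := interior_subset (hlr ⟨hltr.le, le_rfl⟩)
  rcases hc.2.eq_or_lt with rfl | hcr
  · rwa [hκ.hitProb_self hrI hltr.ne]
  · have hsub' : Set.uIcc a r ⊆ interior I := by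
      rw [Set.uIcc_of_le har.le]
      exact (Set.Icc_subset_Icc ha.1 le_rfl).trans hlr
    have hcu : c ∈ Set.uIcc a r := by
      rw [Set.uIcc_of_le har.le]
      exact ⟨hac.le, hcr.le⟩
    -- With exit interval `(a, r)`, the value at `c` is a convex combination of the value at `a`,
    -- which is below `1`, and of `1`, the latter with positive weight.
    have h2 := hκ.hitProb_eq_combination hlr ha.1 hac hcr le_rfl
    rw [hκ.hitProb_self hrI hltr.ne] at h2
    have h3 := hκ.hitProb_add_hitProb hsub' har.ne hcu
    have h4 := hκ.hitProb_pos hsub' hcu hac.ne'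
    nlinarith

/-- The intermediate value theorem, by a supremum argument. Continuity from the left is direct;
continuity from the right comes from the reflected function `hitProb κ l r`, which is one minus the
original. -/
theorem exists_hitProb_eq (hκ : IsRegularDiffusion I κ) (hlr : Set.Icc l r ⊆ interior I)
    {a b : ℝ} (hla : l ≤ a) (hab : a < b) (hbr : b ≤ r) {v : ℝ} (hva : hitProb κ r l a < v)
    (hvb : v < hitProb κ r l b) : ∃ c, a < c ∧ c < b ∧ hitProb κ r l c = v := by
  have hltr : l < r := (hla.trans_lt hab).trans_le hbr
  have hmono := hκ.strictMonoOn_hitProb hlr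
  have hsub : Set.uIcc l r ⊆ interior I := by rwa [Set.uIcc_of_le hltr.le]
  have hsub' : Set.uIcc r l ⊆ interior I := by rwa [Set.uIcc_comm]
  have hflip : ∀ x ∈ Set.Icc l r, hitProb κ r l x = 1 - hitProb κ l r x := by
    intro x hx
    have := hκ.hitProb_add_hitProb hsub hltr.ne (z := x) (by rwa [Set.uIcc_of_le hltr.le])
    linarith
  set S : Set ℝ := {x | x ∈ Set.Icc a b ∧ hitProb κ r l x ≤ v} with hS
  have haS : a ∈ S := ⟨⟨le_rfl, hab.le⟩, hva.le⟩
  have hSb : BddAbove S := ⟨b, fun x hx => hx.1.2⟩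
  set c := sSup S with hc
  have hac : a ≤ c := le_csSup hSb haS
  have hcb : c ≤ b := csSup_le ⟨a, haS⟩ fun x hx => hx.1.2
  have hcI : c ∈ Set.Icc l r := ⟨hla.trans hac, hcb.trans hbr⟩
  -- The factor `1/2` keeps the sequence between `c` and the midpoint of `c` and `d`, the auxiliary
  -- point `z` in `tendsto_hitProb`.
  have hseq : ∀ d : ℝ, Tendsto (fun n : ℕ => c + (d - c) * (1 / ((n : ℝ) + 1)) / 2) atTop (𝓝 c) := by
    intro d
    have := ((tendsto_one_div_add_atTop_nhds_zero_nat (𝕜 := ℝ)).const_mul (d - c)).div_const 2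
    simpa using this.const_add c
  have hfrac : ∀ n : ℕ, 0 < 1 / ((n : ℝ) + 1) ∧ 1 / ((n : ℝ) + 1) ≤ 1 := fun n =>
    ⟨by positivity, by rw [div_le_one (by positivity)]; linarith [n.cast_nonneg (α := ℝ)]⟩
  have hle : hitProb κ r l c ≤ v := by
    rcases hac.eq_or_lt with h | h
    · rw [← h]
      exact hva.le
    · refine le_of_tendsto' (hκ.tendsto_hitProb hsub hltr.ne (z := c + (a - c) / 2)
        (x := fun n : ℕ => c + (a - c) * (1 / ((n : ℝ) + 1)) / 2) ?_ ?_ ?_ ?_ (hseq a)) fun n => ?_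
      · rwa [Set.uIcc_of_le hltr.le]
      · rw [Set.uIcc_of_le hcI.1]
        constructor <;> linarith
      · linarith
      · intro n
        obtain ⟨h1, h2⟩ := hfrac n
        rw [Set.uIcc_of_le (by linarith)]
        constructor <;> nlinarith
      · obtain ⟨h1, h2⟩ := hfrac n
        obtain ⟨x, hx, hlt⟩ := exists_lt_of_lt_csSup ⟨a, haS⟩
          (show c + (a - c) * (1 / ((n : ℝ) + 1)) / 2 < sSup S by rw [← hc]; nlinarith)
        refine le_trans (hmono.monotoneOn ?_ ?_ hlt.le) hx.2
        · constructor <;> nlinarith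
        · exact ⟨hla.trans hx.1.1, hx.1.2.trans hbr⟩
  have hge : v ≤ hitProb κ r l c := by
    rcases hcb.eq_or_lt with h | h
    · rw [h]
      exact hvb.le
    · rw [hflip c hcI]
      have hle' : hitProb κ l r c ≤ 1 - v := by
        refine le_of_tendsto' (hκ.tendsto_hitProb hsub' hltr.ne' (z := c + (b - c) / 2)
          (x := fun n : ℕ => c + (b - c) * (1 / ((n : ℝ) + 1)) / 2) ?_ ?_ ?_ ?_ (hseq b))
          fun n => ?_
        · rwa [Set.uIcc_comm, Set.uIcc_of_le hltr.le]
        · rw [Set.uIcc_comm, Set.uIcc_of_le hcI.2]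
          constructor <;> linarith
        · linarith
        · intro n
          obtain ⟨h1, h2⟩ := hfrac n
          rw [Set.uIcc_comm, Set.uIcc_of_le (by linarith)]
          constructor <;> nlinarith
        · obtain ⟨h1, h2⟩ := hfrac n
          have hmem : c + (b - c) * (1 / ((n : ℝ) + 1)) / 2 ∈ Set.Icc a b := by
            constructor <;> nlinarith
          have hn : v < hitProb κ r l (c + (b - c) * (1 / ((n : ℝ) + 1)) / 2) := by
            by_contra hno
            have := le_csSup hSb (show c + (b - c) * (1 / ((n : ℝ) + 1)) / 2 ∈ S from
              ⟨hmem, not_lt.1 hno⟩)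
            rw [← hc] at this
            nlinarith
          rw [hflip _ ⟨hla.trans hmem.1, hmem.2.trans hbr⟩] at hn
          linarith
      linarith
  have heq := le_antisymm hle hge
  refine ⟨c, lt_of_le_of_ne hac ?_, lt_of_le_of_ne hcb ?_, heq⟩
  · intro h
    rw [← h] at heq
    exact hva.ne heq
  · intro h
    rw [h] at heq
    exact hvb.ne' heq

end Interval

end IsRegularDiffusion

/-! ### Stopped values and finitely supported laws -/

/-- The measure on the extended real line with mass `p x` at each `x ∈ S`. -/
noncomputable def atomicLaw (S : Finset ℝ) (p : ℝ → ℝ) : Measure EReal :=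
  ∑ x ∈ S, ENNReal.ofReal (p x) • Measure.dirac (x : EReal)

theorem isProbabilityMeasure_atomicLaw {S : Finset ℝ} {p : ℝ → ℝ} (hp : ∀ x ∈ S, 0 ≤ p x)
    (hsum : ∑ x ∈ S, p x = 1) : IsProbabilityMeasure (atomicLaw S p) := by
  constructor
  simp only [atomicLaw, Measure.coe_finsetSum, Finset.sum_apply, Measure.smul_apply, measure_univ,
    smul_eq_mul, mul_one]
  rw [← ENNReal.ofReal_sum_of_nonneg hp, hsum, ENNReal.ofReal_one]

theorem atomicLaw_erase {S : Finset ℝ} {p : ℝ → ℝ} {x : ℝ} (hx : p x = 0) :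
    atomicLaw (S.erase x) p = atomicLaw S p :=
  Finset.sum_erase _ (by simp [hx])

theorem atomicLaw_mixture {S : Finset ℝ} {p p₁ p₂ : ℝ → ℝ} {a : ℝ} (ha : 0 ≤ a) (ha' : a ≤ 1)
    (h₁ : ∀ x ∈ S, 0 ≤ p₁ x) (h₂ : ∀ x ∈ S, 0 ≤ p₂ x)
    (hp : ∀ x ∈ S, p x = a * p₁ x + (1 - a) * p₂ x) :
    atomicLaw S p = ENNReal.ofReal a • atomicLaw S p₁ + ENNReal.ofReal (1 - a) • atomicLaw S p₂ := by
  simp only [atomicLaw, Finset.smul_sum, ← Finset.sum_add_distrib]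
  refine Finset.sum_congr rfl fun x hx => ?_
  rw [hp x hx, ENNReal.ofReal_add (mul_nonneg ha (h₁ x hx))
    (mul_nonneg (sub_nonneg.2 ha') (h₂ x hx)), ENNReal.ofReal_mul ha,
    ENNReal.ofReal_mul (sub_nonneg.2 ha'), add_smul, mul_smul, mul_smul]

section Stopped

variable {Ω : Type*} {Y : Ω → C(ℝ≥0, ℝ)} {τ : Ω → WithTop ℝ≥0} {ω : Ω}

theorem tendsto_stoppedProcess_of_eq_coe {t : ℝ≥0} (ht : τ ω = t) :
    Tendsto (fun s : ℝ≥0 => ((stoppedProcess (fun t ω => Y ω t) τ s ω : ℝ) : EReal)) atTop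
      (𝓝 (Y ω t : EReal)) := by
  refine tendsto_const_nhds.congr' ?_
  filter_upwards [eventually_ge_atTop t] with s hs
  rw [stoppedProcess_eq_of_ge (by rw [ht]; exact WithTop.coe_le_coe.2 hs), ht]
  rfl

theorem exitValue_eq_of_tendsto {x : EReal} (h : Tendsto (fun s : ℝ≥0 =>
    ((stoppedProcess (fun t ω => Y ω t) τ s ω : ℝ) : EReal)) atTop (𝓝 x)) :
    exitValue Y τ ω = x := h.limsup_eq

theorem exitValue_of_eq_coe {t : ℝ≥0} (ht : τ ω = t) : exitValue Y τ ω = Y ω t :=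
  exitValue_eq_of_tendsto (tendsto_stoppedProcess_of_eq_coe ht)

theorem thresholdTime_eq_hitFrom (Y : Ω → C(ℝ≥0, ℝ)) (a b : ℝ) :
    thresholdTime Y a b = fun ω => hitFrom {z | ¬ (a < z ∧ z < b)} 0 (Y ω) := by
  have hC : IsClosed {z : ℝ | ¬ (a < z ∧ z < b)} := (isOpen_Ioo (a := a) (b := b)).isClosed_compl
  have hset : {z : ℝ | ¬ ((a : EReal) < (z : EReal) ∧ (z : EReal) < (b : EReal))} =
      {z : ℝ | ¬ (a < z ∧ z < b)} := by
    ext z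
    simp only [EReal.coe_lt_coe_iff]
  funext ω
  rw [thresholdTime, hset, hittingAfter]
  split_ifs with h
  · obtain ⟨j, -, hj⟩ := h
    obtain ⟨t, ht, -, hmem, hmin⟩ := exists_hitFrom_eq hC (u := 0) (f := Y ω) ⟨j, by simp, hj⟩
    rw [ht]
    refine congrArg _ (le_antisymm (csInf_le (OrderBot.bddBelow _) ⟨zero_le, hmem⟩) ?_)
    exact le_csInf ⟨j, zero_le, hj⟩ fun v hv => hmin v (by simp) hv.2
  · refine (sInf_eq_top.2 ?_).symm
    rintro _ ⟨t, rfl, -, ht⟩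
    exact absurd ⟨t, zero_le, ht⟩ h

end Stopped

/-- A path that starts between the adjacent points `a < b` of `S` reaches `S` at that one of the
two points which it reaches first. -/
theorem exists_hitFrom_eq_of_shift_mem {S : Set ℝ} (hS : IsClosed S) {a b e e' : ℝ}
    (haS : a ∈ S) (hbS : b ∈ S) (hadj : ∀ x ∈ S, x ≤ a ∨ b ≤ x)
    (he : (e = a ∧ e' = b) ∨ (e = b ∧ e' = a)) {f : C(ℝ≥0, ℝ)} {t : ℝ≥0}
    (hat : a < f t) (hbt : f t < b) (h : shiftPath t f ∈ hitsBefore e e') :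
    ∃ t' : ℝ≥0, hitFrom S t f = t' ∧ f t' = e := by
  obtain ⟨u, hu, hue⟩ := h
  have heS : f (t + u) ∈ S := by
    have hu : f (t + u) = e := hu
    rcases he with ⟨rfl, rfl⟩ | ⟨rfl, rfl⟩ <;> rwa [hu]
  obtain ⟨t', ht', htt', hmem, hmin⟩ := exists_hitFrom_eq hS (u := t) (f := f)
    ⟨t + u, WithTop.coe_le_coe.2 (by simp), heS⟩
  have htt : t ≤ t' := WithTop.coe_le_coe.1 htt'
  have htu : t' ≤ t + u := hmin _ (WithTop.coe_le_coe.2 (by simp)) heS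
  refine ⟨t', ht', ?_⟩
  have hne : f t' ≠ e' := by
    have := hue (t' - t) (by rwa [tsub_le_iff_left])
    simpa [add_tsub_cancel_of_le htt] using this
  have hpass : ∀ x ∈ S, x ∈ Set.uIcc (f t) (f t') → f t' = x := by
    intro x hx hxm
    obtain ⟨v, hv1, hv2, hv⟩ := exists_mem_of_mem_uIcc f htt hxm
    have := hmin v (WithTop.coe_le_coe.2 hv1) (by rwa [hv])
    rw [le_antisymm this hv2, hv]
  rcases hadj _ hmem with h1 | h1
  · have := hpass a haS (Set.mem_uIcc.2 (Or.inr ⟨h1, hat.le⟩))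
    rcases he with ⟨rfl, rfl⟩ | ⟨rfl, rfl⟩
    · exact this
    · exact absurd this hne
  · have := hpass b hbS (Set.mem_uIcc.2 (Or.inl ⟨hbt.le, h1⟩))
    rcases he with ⟨rfl, rfl⟩ | ⟨rfl, rfl⟩
    · exact absurd this hne
    · exact this

namespace IsDiffusionFrom

variable {Ω : Type*} {m : MeasurableSpace Ω} {I : Set ℝ} {κ : Kernel ℝ C(ℝ≥0, ℝ)}
  {𝓕 : Filtration ℝ≥0 m} {P : Measure Ω} {Y : Ω → C(ℝ≥0, ℝ)} {y : ℝ}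

theorem aemeasurable_exitValue (h : IsDiffusionFrom I κ 𝓕 P Y y) {τ : Ω → WithTop ℝ≥0}
    (hτ : τ ∈ stoppingClass 𝓕 P Y) : AEMeasurable (exitValue Y τ) P := by
  refine aemeasurable_of_tendsto_metrizable_ae (ι := ℕ) atTop
    (f := fun n ω => ((stoppedProcess (fun t ω => Y ω t) τ (n : ℝ≥0) ω : ℝ) : EReal)) ?_ ?_
  · intro n
    exact (measurable_coe_real_ereal.comp
      (IsStronglyProgressive.stronglyMeasurable_stoppedProcess h.isStronglyProgressive hτ.1
        _).measurable).aemeasurable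
  · filter_upwards [hτ.2] with ω hω
    obtain ⟨x, hx⟩ := hω
    rw [exitValue_eq_of_tendsto hx]
    exact hx.comp tendsto_natCast_atTop_atTop

theorem measurableSet_stopped_eq (h : IsDiffusionFrom I κ 𝓕 P Y y) {τ : Ω → WithTop ℝ≥0}
    (hτ : IsStoppingTime 𝓕 τ) (x : ℝ) :
    MeasurableSet {ω | ∃ t : ℝ≥0, τ ω = t ∧ Y ω t = x} :=
  hτ.measurableSpace_le _ (h.measurableSet_exists_eq hτ (measurableSet_singleton x))

theorem pairwiseDisjoint_stopped_eq (Y : Ω → C(ℝ≥0, ℝ)) (τ : Ω → WithTop ℝ≥0) (s : Set ℝ) :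
    s.PairwiseDisjoint fun x => {ω | ∃ t : ℝ≥0, τ ω = t ∧ Y ω t = x} := by
  intro x _ x' _ hne
  refine Set.disjoint_left.2 ?_
  rintro ω ⟨t, ht, hx⟩ ⟨t', ht', hx'⟩
  obtain rfl : t = t' := WithTop.coe_injective (ht.symm.trans ht')
  exact hne (hx.symm.trans hx')

/-- The stopping time `τ` is finite and the law of `Y_τ` has mass `p x` at each `x ∈ S`, as soon as
these masses add up to one and are lower bounds. -/
theorem hasLaw_atomicLaw (h : IsDiffusionFrom I κ 𝓕 P Y y) {τ : Ω → WithTop ℝ≥0}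
    (hτ : IsStoppingTime 𝓕 τ) {S : Finset ℝ} {p : ℝ → ℝ} (hsum : ∑ x ∈ S, p x = 1)
    (hp : ∀ x ∈ S, p x ≤ P.real {ω | ∃ t : ℝ≥0, τ ω = t ∧ Y ω t = x}) :
    τ ∈ stoppingClass 𝓕 P Y ∧ HasLaw (exitValue Y τ) (atomicLaw S p) P := by
  have := h.prob
  set E : ℝ → Set Ω := fun x => {ω | ∃ t : ℝ≥0, τ ω = t ∧ Y ω t = x} with hE
  have hEm : ∀ x ∈ S, MeasurableSet (E x) := fun x _ => h.measurableSet_stopped_eq hτ x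
  have hdisj := pairwiseDisjoint_stopped_eq Y τ (S : Set ℝ)
  have hU : P.real (⋃ x ∈ S, E x) = ∑ x ∈ S, P.real (E x) := measureReal_biUnion_finset hdisj hEm
  have hle : P.real (⋃ x ∈ S, E x) ≤ 1 := measureReal_le_one
  have hge : ∑ x ∈ S, p x ≤ ∑ x ∈ S, P.real (E x) := Finset.sum_le_sum hp
  -- The events are disjoint, so their probabilities add up to at most one; the lower bounds already
  -- add up to one, so none is strict.
  have heq : ∀ x ∈ S, p x = P.real (E x) :=
    (Finset.sum_eq_sum_iff_of_le hp).1 (le_antisymm hge (by rw [hsum, ← hU]; exact hle))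
  have hone : P.real (⋃ x ∈ S, E x) = 1 := le_antisymm hle (by rw [hU, ← hsum]; exact hge)
  have hae : ∀ᵐ ω ∂P, ∃ x ∈ S, ω ∈ E x := by
    have h1 : P (⋃ x ∈ S, E x) = 1 := by
      rw [← ENNReal.toReal_eq_one_iff]
      exact hone
    have h2 := (prob_compl_eq_zero_iff (Finset.measurableSet_biUnion S hEm)).2 h1
    filter_upwards [measure_eq_zero_iff_ae_notMem.1 h2] with ω hω
    simpa using hω
  have hmem : τ ∈ stoppingClass 𝓕 P Y := by
    refine ⟨hτ, ?_⟩
    filter_upwards [hae] with ω hω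
    obtain ⟨x, -, t, ht, -⟩ := hω
    exact ⟨_, tendsto_stoppedProcess_of_eq_coe ht⟩
  refine ⟨hmem, h.aemeasurable_exitValue hmem, ?_⟩
  ext B hB
  rw [Measure.map_apply_of_aemeasurable (h.aemeasurable_exitValue hmem) hB]
  classical
  have h1 : exitValue Y τ ⁻¹' B =ᵐ[P] (⋃ x ∈ S.filter (fun x : ℝ => (x : EReal) ∈ B), E x : Set Ω) := by
    filter_upwards [hae] with ω hω
    obtain ⟨x, hxS, t, ht, hx⟩ := hω
    refine propext ?_
    change exitValue Y τ ω ∈ B ↔ ω ∈ ⋃ x ∈ S.filter (fun x : ℝ => (x : EReal) ∈ B), E x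
    rw [exitValue_of_eq_coe ht, hx]
    simp only [Set.mem_iUnion, Finset.mem_filter, exists_prop]
    constructor
    · exact fun hxB => ⟨x, ⟨hxS, hxB⟩, t, ht, hx⟩
    · rintro ⟨x', ⟨-, hB'⟩, t', ht', hx'⟩
      obtain rfl : t = t' := WithTop.coe_injective (ht.symm.trans ht')
      rwa [← hx, hx']
  rw [measure_congr h1, measure_biUnion_finset
    (hdisj.subset (Finset.coe_subset.2 (Finset.filter_subset _ _))) fun x hx => hEm x (Finset.mem_of_mem_filter x hx)]
  simp only [atomicLaw, Measure.coe_finsetSum, Finset.sum_apply, Measure.smul_apply, smul_eq_mul,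
    Measure.dirac_apply' _ hB, Set.indicator_apply, Pi.one_apply, mul_ite, mul_one, mul_zero]
  rw [Finset.sum_filter]
  refine Finset.sum_congr rfl fun x hx => ?_
  rw [heq x hx, ofReal_measureReal]

/-! ### Embedding finitely supported laws -/

section Interval

variable {l r : ℝ}

theorem eq_of_hitProb_eq (h : IsDiffusionFrom I κ 𝓕 P Y y) (hlr : Set.Icc l r ⊆ interior I)
    {x z : ℝ} (hx : x ∈ Set.Icc l r) (hz : z ∈ Set.Icc l r)
    (hxz : hitProb κ r l x = hitProb κ r l z) : x = z :=
  (h.diffusion.strictMonoOn_hitProb hlr).injOn hx hz hxz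

/-- The weights of the two end points in the exit law from `(a, b)`. -/
theorem mul_hitProb_eq (h : IsDiffusionFrom I κ 𝓕 P Y y) (hlr : Set.Icc l r ⊆ interior I)
    {a b c pa pb : ℝ} (hla : l ≤ a) (hac : a < c) (hcb : c < b) (hbr : b ≤ r)
    (hp : (pa + pb) * hitProb κ r l c = pa * hitProb κ r l a + pb * hitProb κ r l b) :
    (pa + pb) * hitProb κ a b c = pa ∧ (pa + pb) * hitProb κ b a c = pb := by
  have hκ := h.diffusion
  have hab := hac.trans hcb
  have h1 := hκ.hitProb_eq_combination hlr hla hac hcb hbr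
  have h2 := hκ.hitProb_add_hitProb (a := a) (b := b) (z := c)
    (by rw [Set.uIcc_of_le hab.le]; exact (Set.Icc_subset_Icc hla hbr).trans hlr) hab.ne
    (by rw [Set.uIcc_of_le hab.le]; exact ⟨hac.le, hcb.le⟩)
  have h3 : hitProb κ r l a < hitProb κ r l b :=
    hκ.strictMonoOn_hitProb hlr ⟨hla, hab.le.trans hbr⟩ ⟨hla.trans hab.le, hbr⟩ hab
  have h4 : hitProb κ a b c = 1 - hitProb κ b a c := by linarith
  -- Total mass and scale mean are two linear equations for the two exit weights; strict
  -- monotonicity of the scale function makes them independent.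
  have h5 : ((pa + pb) * hitProb κ b a c - pb) * (hitProb κ r l b - hitProb κ r l a) = 0 := by
    rw [h1, h4] at hp
    linear_combination hp
  have h6 : (pa + pb) * hitProb κ b a c - pb = 0 :=
    (mul_eq_zero.1 h5).resolve_right (sub_ne_zero.2 h3.ne')
  rw [h4]
  constructor <;> linarith

/-- Every law with finitely many atoms in `[l, r]` under which the scale function has the right
mean is embedded by a stopping time. -/
theorem exists_embedding (h : IsDiffusionFrom I κ 𝓕 P Y y) (hlr : Set.Icc l r ⊆ interior I)
    (hy : y ∈ Set.Icc l r) (S : Finset ℝ) (p : ℝ → ℝ) (hS : ∀ x ∈ S, x ∈ Set.Icc l r)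
    (hp : ∀ x ∈ S, 0 ≤ p x) (hsum : ∑ x ∈ S, p x = 1)
    (hmean : ∑ x ∈ S, p x * hitProb κ r l x = hitProb κ r l y) :
    ∃ τ, IsStoppingTime 𝓕 τ ∧
      ∀ x ∈ S, p x ≤ P.real {ω | ∃ t : ℝ≥0, τ ω = t ∧ Y ω t = x} := by
  have := h.prob
  have hκ := h.diffusion
  induction hn : S.card using Nat.strong_induction_on generalizing S p with
  | _ n ih =>
  subst hn
  by_cases hzero : ∃ x ∈ S, p x = 0
  · obtain ⟨x₀, hx₀, h0⟩ := hzero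
    obtain ⟨τ, hτ, hτp⟩ := ih _ (Finset.card_erase_lt_of_mem hx₀) (S.erase x₀) p
      (fun x hx => hS x (Finset.mem_of_mem_erase hx)) (fun x hx => hp x (Finset.mem_of_mem_erase hx))
      (by rw [Finset.sum_erase _ h0, hsum])
      (by rw [Finset.sum_erase _ (by rw [h0, zero_mul]), hmean]) rfl
    refine ⟨τ, hτ, fun x hx => ?_⟩
    rcases eq_or_ne x x₀ with rfl | hne
    · rw [h0]
      exact measureReal_nonneg
    · exact hτp x (Finset.mem_erase.2 ⟨hne, hx⟩)
  push Not at hzero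
  have hpos : ∀ x ∈ S, 0 < p x := fun x hx => lt_of_le_of_ne (hp x hx) (hzero x hx).symm
  have hne : S.Nonempty := by
    rw [Finset.nonempty_iff_ne_empty]
    rintro rfl
    simp at hsum
  set b := S.max' hne with hb
  have hbS : b ∈ S := S.max'_mem hne
  rcases (S.erase b).eq_empty_or_nonempty with hemp | hne'
  · have hSb : S = {b} := by
      rw [← Finset.insert_erase hbS, hemp]
      rfl
    rw [hSb, Finset.sum_singleton] at hsum hmean
    rw [hsum, one_mul] at hmean
    have hby : b = y := h.eq_of_hitProb_eq hlr (hS b hbS) hy hmean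
    refine ⟨fun _ => (0 : ℝ≥0), isStoppingTime_const 𝓕 0, ?_⟩
    rw [hSb]
    intro x hx
    rw [Finset.mem_singleton] at hx
    subst hx
    rw [hsum]
    have h1 : {ω | ∃ t : ℝ≥0, ((0 : ℝ≥0) : WithTop ℝ≥0) = t ∧ Y ω t = b} =ᵐ[P]
        (Set.univ : Set Ω) := by
      filter_upwards [h.start] with ω hω
      exact eq_true (show ∃ t : ℝ≥0, _ from ⟨0, rfl, hω.trans hby.symm⟩)
    rw [measureReal_congr h1, probReal_univ]
  -- The two largest atoms are merged into one, so that the induction hypothesis applies. Being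
  -- adjacent, they enclose no other atom, and a path restarted between them next meets `S` at one
  -- of the two.
  set a := (S.erase b).max' hne' with ha
  have haSb : a ∈ S.erase b := (S.erase b).max'_mem hne'
  have haS : a ∈ S := Finset.mem_of_mem_erase haSb
  have hab : a < b := lt_of_le_of_ne (S.le_max' a haS) (Finset.ne_of_mem_erase haSb)
  set S₀ := (S.erase b).erase a with hS₀
  have hS₀S : ∀ x ∈ S₀, x ∈ S := fun x hx => Finset.mem_of_mem_erase (Finset.mem_of_mem_erase hx)
  have hS₀a : ∀ x ∈ S₀, x < a := fun x hx =>
    lt_of_le_of_ne ((S.erase b).le_max' x (Finset.mem_of_mem_erase hx)) (Finset.ne_of_mem_erase hx)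
  have hsplit : ∀ g : ℝ → ℝ, ∑ x ∈ S, g x = g a + g b + ∑ x ∈ S₀, g x := by
    intro g
    rw [← Finset.add_sum_erase S g hbS, ← Finset.add_sum_erase (S.erase b) g haSb]
    ring
  have hla := (hS a haS).1
  have hbr := (hS b hbS).2
  have hsab : hitProb κ r l a < hitProb κ r l b :=
    hκ.strictMonoOn_hitProb hlr (hS a haS) (hS b hbS) hab
  have hpa := hpos a haS
  have hpb := hpos b hbS
  -- The merged atom sits at the barycentre of `a` and `b` in the scale of `hitProb κ r l`, which
  -- preserves the mean.
  obtain ⟨c, hac, hcb, hc⟩ := hκ.exists_hitProb_eq hlr hla hab hbr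
    (v := (p a * hitProb κ r l a + p b * hitProb κ r l b) / (p a + p b))
    (by rw [lt_div_iff₀ (by positivity)]; nlinarith)
    (by rw [div_lt_iff₀ (by positivity)]; nlinarith)
  have hc' : (p a + p b) * hitProb κ r l c = p a * hitProb κ r l a + p b * hitProb κ r l b := by
    rw [hc]
    field_simp
  have hcS₀ : c ∉ S₀ := fun hmem => absurd (hS₀a c hmem) hac.not_gt
  set p' : ℝ → ℝ := fun x => if x = c then p a + p b else p x with hp'
  have hp'c : p' c = p a + p b := by simp [hp']
  have hp'x : ∀ x ∈ S₀, p' x = p x := fun x hx => by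
    have : x ≠ c := fun hxc => hcS₀ (hxc ▸ hx)
    simp [hp', this]
  have hcard : (insert c S₀).card < S.card := by
    rw [Finset.card_insert_of_notMem hcS₀, hS₀, Finset.card_erase_of_mem haSb,
      Finset.card_erase_of_mem hbS]
    have h1 := Finset.card_pos.2 hne'
    rw [Finset.card_erase_of_mem hbS] at h1
    omega
  obtain ⟨τ', hτ', hτp'⟩ := ih _ hcard (insert c S₀) p'
    (by
      intro x hx
      rcases Finset.mem_insert.1 hx with rfl | hx
      · exact ⟨hla.trans hac.le, hcb.le.trans hbr⟩
      · exact hS x (hS₀S x hx))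
    (by
      intro x hx
      rcases Finset.mem_insert.1 hx with rfl | hx
      · rw [hp'c]
        positivity
      · rw [hp'x x hx]
        exact hp x (hS₀S x hx))
    (by
      rw [Finset.sum_insert hcS₀, hp'c, Finset.sum_congr rfl hp'x, ← hsum, hsplit])
    (by
      rw [Finset.sum_insert hcS₀, hp'c, hc', ← hmean, hsplit]
      congr 1
      exact Finset.sum_congr rfl fun x hx => by rw [hp'x x hx])
    rfl
  have hSc : IsClosed (S : Set ℝ) := S.finite_toSet.isClosed
  have hadj : ∀ x ∈ (S : Set ℝ), x ≤ a ∨ b ≤ x := by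
    intro x hx
    by_cases hxb : x = b
    · exact Or.inr hxb.ge
    · exact Or.inl ((S.erase b).le_max' x (Finset.mem_erase.2 ⟨hxb, hx⟩))
  refine ⟨fun ω => hitFrom S (τ' ω) (Y ω), hSc.isStoppingTime_hitFrom h.adapted hτ', ?_⟩
  have hweights := h.mul_hitProb_eq hlr hla hac hcb hbr hc'
  have hend : ∀ e e', (e = a ∧ e' = b) ∨ (e = b ∧ e' = a) → (p a + p b) * hitProb κ e e' c ≤
      P.real {ω | ∃ t : ℝ≥0, hitFrom S (τ' ω) (Y ω) = t ∧ Y ω t = e} := by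
    intro e e' he
    have h1 := hτp' c (Finset.mem_insert_self _ _)
    rw [hp'c] at h1
    calc (p a + p b) * hitProb κ e e' c
        ≤ P.real {ω | ∃ t : ℝ≥0, τ' ω = t ∧ Y ω t = c} * hitProb κ e e' c :=
          mul_le_mul_of_nonneg_right h1 measureReal_nonneg
      _ = P.real {ω | ∃ t : ℝ≥0, τ' ω = t ∧ Y ω t = c ∧ shiftPath t (Y ω) ∈ hitsBefore e e'} := by
          simp only [hitProb, measureReal_def]
          rw [h.measure_shift_eq hτ' c (measurableSet_hitsBefore e e'), ENNReal.toReal_mul]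
      _ ≤ _ := by
          refine measureReal_mono ?_
          rintro ω ⟨t, ht, hct, hsh⟩
          obtain ⟨t', ht', hte⟩ := exists_hitFrom_eq_of_shift_mem hSc (Finset.mem_coe.2 haS)
            (Finset.mem_coe.2 hbS) hadj he (by rw [hct]; exact hac) (by rw [hct]; exact hcb) hsh
          exact ⟨t', by rw [ht]; exact ht', hte⟩
  intro x hx
  by_cases hxb : x = b
  · subst hxb
    have := hend b a (Or.inr ⟨rfl, rfl⟩)
    rwa [hweights.2] at this
  by_cases hxa : x = a
  · rw [hxa]
    have := hend a b (Or.inl ⟨rfl, rfl⟩)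
    rwa [hweights.1] at this
  have hx₀ : x ∈ S₀ := Finset.mem_erase.2 ⟨hxa, Finset.mem_erase.2 ⟨hxb, hx⟩⟩
  have h1 := hτp' x (Finset.mem_insert_of_mem hx₀)
  rw [hp'x x hx₀] at h1
  refine h1.trans (measureReal_mono ?_)
  rintro ω ⟨t, ht, htx⟩
  refine ⟨t, ?_, htx⟩
  change hitFrom S (τ' ω) (Y ω) = t
  rw [ht]
  exact hitFrom_eq_coe_of hSc le_rfl (by rw [htx]; exact hx) fun v hv _ => WithTop.coe_le_coe.1 hv

end Interval

end IsDiffusionFrom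

/-! ### Reduction to laws with at most two atoms -/

namespace IsDiffusionFrom

variable {Ω : Type*} {m : MeasurableSpace Ω} {I : Set ℝ} {κ : Kernel ℝ C(ℝ≥0, ℝ)}
  {𝓕 : Filtration ℝ≥0 m} {P : Measure Ω} {Y : Ω → C(ℝ≥0, ℝ)} {y l r : ℝ}

theorem isStoppingTime_thresholdTime (h : IsDiffusionFrom I κ 𝓕 P Y y) (a b : ℝ) :
    IsStoppingTime 𝓕 (thresholdTime Y a b) := by
  rw [thresholdTime_eq_hitFrom]
  exact ((isOpen_Ioo (a := a) (b := b)).isClosed_compl).isStoppingTime_hitFrom h.adapted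
    (isStoppingTime_const 𝓕 0)

/-- A law with at most two atoms and the right mean is the exit law from an interval. -/
theorem exists_threshold_of_card_le_two (h : IsDiffusionFrom I κ 𝓕 P Y y)
    (hlr : Set.Icc l r ⊆ interior I) (hy : y ∈ Set.Icc l r) {S : Finset ℝ} {p : ℝ → ℝ}
    (hS : ∀ x ∈ S, x ∈ Set.Icc l r) (hp : ∀ x ∈ S, 0 < p x) (hsum : ∑ x ∈ S, p x = 1)
    (hmean : ∑ x ∈ S, p x * hitProb κ r l x = hitProb κ r l y) (hcard : S.card ≤ 2) :
    ∃ a ∈ Set.Icc l r, ∃ b ∈ Set.Icc l r, a ≤ y ∧ y ≤ b ∧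
      ∀ x ∈ S, p x ≤ P.real {ω | ∃ t : ℝ≥0, thresholdTime Y a b ω = t ∧ Y ω t = x} := by
  have := h.prob
  have hκ := h.diffusion
  have hone : ∀ x, S = {x} → ∃ a ∈ Set.Icc l r, ∃ b ∈ Set.Icc l r, a ≤ y ∧ y ≤ b ∧
      ∀ x ∈ S, p x ≤ P.real {ω | ∃ t : ℝ≥0, thresholdTime Y a b ω = t ∧ Y ω t = x} := by
    rintro x rfl
    rw [Finset.sum_singleton] at hsum hmean
    rw [hsum, one_mul] at hmean
    have hxy : x = y := h.eq_of_hitProb_eq hlr (hS x (by simp)) hy hmean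
    subst hxy
    -- The interval `(y, y)` is empty, so its exit time is `0`.
    refine ⟨x, hy, x, hy, le_rfl, le_rfl, fun z hz => ?_⟩
    obtain rfl := Finset.mem_singleton.1 hz
    rw [hsum, thresholdTime_eq_hitFrom]
    have hC : IsClosed {w : ℝ | ¬ (z < w ∧ w < z)} := (isOpen_Ioo (a := z) (b := z)).isClosed_compl
    have h1 : {ω | ∃ t : ℝ≥0, hitFrom {w : ℝ | ¬ (z < w ∧ w < z)} 0 (Y ω) = t ∧ Y ω t = z} =ᵐ[P]
        (Set.univ : Set Ω) := by
      filter_upwards [h.start] with ω hω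
      refine eq_true (show ∃ t : ℝ≥0, _ from ⟨0, ?_, hω⟩)
      exact hitFrom_eq_coe_of hC (by simp) (by rw [hω]; simp) fun v _ _ => zero_le
    rw [measureReal_congr h1, probReal_univ]
  have htwo : ∀ a b, a < b → S = {a, b} → ∃ a ∈ Set.Icc l r, ∃ b ∈ Set.Icc l r, a ≤ y ∧ y ≤ b ∧
      ∀ x ∈ S, p x ≤ P.real {ω | ∃ t : ℝ≥0, thresholdTime Y a b ω = t ∧ Y ω t = x} := by
    rintro a b hab rfl
    have haI := hS a (by simp)
    have hbI := hS b (by simp)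
    have hpa := hp a (by simp)
    have hpb := hp b (by simp)
    rw [Finset.sum_pair hab.ne] at hsum hmean
    have hmono := hκ.strictMonoOn_hitProb hlr
    have hs := hmono haI hbI hab
    have hay : a < y := by
      rw [← hmono.lt_iff_lt haI hy, ← hmean, show p a = 1 - p b by linarith]
      nlinarith
    have hyb : y < b := by
      rw [← hmono.lt_iff_lt hy hbI, ← hmean, show p b = 1 - p a by linarith]
      nlinarith
    have hw := h.mul_hitProb_eq hlr haI.1 hay hyb hbI.2 (pa := p a) (pb := p b)
      (by rw [hsum, one_mul, hmean])
    rw [hsum, one_mul, one_mul] at hw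
    set C : Set ℝ := {z | ¬ (a < z ∧ z < b)} with hCdef
    have hC : IsClosed C := (isOpen_Ioo (a := a) (b := b)).isClosed_compl
    have hend : ∀ e e', (e = a ∧ e' = b) ∨ (e = b ∧ e' = a) → hitProb κ e e' y ≤
        P.real {ω | ∃ t : ℝ≥0, thresholdTime Y a b ω = t ∧ Y ω t = e} := by
      intro e e' he
      rw [hitProb, ← h.map_eq,
        map_measureReal_apply h.measurable (measurableSet_hitsBefore e e'),
        thresholdTime_eq_hitFrom]
      refine ENNReal.toReal_mono (measure_ne_top _ _) (measure_mono_ae ?_)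
      filter_upwards [h.start] with ω hω hmem
      have hmem : Y ω ∈ hitsBefore e e' := hmem
      have := exists_hitFrom_eq_of_shift_mem hC (a := a) (b := b) (f := Y ω) (t := 0)
        (by simp [hCdef]) (by simp [hCdef])
        (fun x hx => by
          by_contra hno
          push Not at hno
          exact hx hno) he (by rw [hω]; exact hay) (by rw [hω]; exact hyb)
        (by rwa [shiftPath_zero])
      exact this
    refine ⟨a, haI, b, hbI, hay.le, hyb.le, fun x hx => ?_⟩
    simp only [Finset.mem_insert, Finset.mem_singleton] at hx
    rcases hx with rfl | rfl
    · rw [← hw.1]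
      exact hend _ _ (Or.inl ⟨rfl, rfl⟩)
    · rw [← hw.2]
      exact hend _ _ (Or.inr ⟨rfl, rfl⟩)
  have hcases : S.card = 0 ∨ S.card = 1 ∨ S.card = 2 := by omega
  rcases hcases with h0 | h1 | h2
  · rw [Finset.card_eq_zero.1 h0] at hsum
    simp at hsum
  · obtain ⟨x, hx⟩ := Finset.card_eq_one.1 h1
    exact hone x hx
  · obtain ⟨a, b, hne, hab⟩ := Finset.card_eq_two.1 h2
    rcases lt_or_gt_of_ne hne with hlt | hgt
    · exact htwo a b hlt hab
    · exact htwo b a hgt (by rw [hab, Finset.pair_comm])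

/-- The value of a law with finitely many atoms is at most that of some threshold rule. -/
theorem exists_threshold_ge (h : IsDiffusionFrom I κ 𝓕 P Y y) (hlr : Set.Icc l r ⊆ interior I)
    (hy : y ∈ Set.Icc l r) {V : (Ω → WithTop ℝ≥0) → ℝ} {H : ProbabilityMeasure EReal → ℝ}
    (hV : ∀ τ ∈ stoppingClass 𝓕 P Y, ∀ μ : ProbabilityMeasure EReal,
      HasLaw (exitValue Y τ) (μ : Measure EReal) P → V τ = H μ)
    (hH : IsQuasiconvexOn (exitLaws P Y (stoppingClass 𝓕 P Y)) H)
    (S : Finset ℝ) (p : ℝ → ℝ) (hS : ∀ x ∈ S, x ∈ Set.Icc l r)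
    (hp : ∀ x ∈ S, 0 ≤ p x) (hsum : ∑ x ∈ S, p x = 1)
    (hmean : ∑ x ∈ S, p x * hitProb κ r l x = hitProb κ r l y) (μ : ProbabilityMeasure EReal)
    (hμ : (μ : Measure EReal) = atomicLaw S p) :
    ∃ τ ∈ thresholdClass 𝓕 P Y I y, H μ ≤ V τ := by
  have hκ := h.diffusion
  induction hn : S.card using Nat.strong_induction_on generalizing S p μ with
  | _ n ih =>
  subst hn
  have hreduce : ∀ (q : ℝ → ℝ) (x₀ : ℝ), x₀ ∈ S → q x₀ = 0 → (∀ x ∈ S, 0 ≤ q x) →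
      ∑ x ∈ S, q x = 1 → ∑ x ∈ S, q x * hitProb κ r l x = hitProb κ r l y →
      ∀ ν : ProbabilityMeasure EReal, (ν : Measure EReal) = atomicLaw S q →
      ∃ τ ∈ thresholdClass 𝓕 P Y I y, H ν ≤ V τ := by
    intro q x₀ hx₀ h0 hq hqsum hqmean ν hν
    exact ih _ (Finset.card_erase_lt_of_mem hx₀) (S.erase x₀) q
      (fun x hx => hS x (Finset.mem_of_mem_erase hx)) (fun x hx => hq x (Finset.mem_of_mem_erase hx))
      (by rw [Finset.sum_erase _ h0, hqsum])
      (by rw [Finset.sum_erase _ (by rw [h0, zero_mul]), hqmean]) ν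
      (by rw [hν, atomicLaw_erase h0]) rfl
  by_cases hzero : ∃ x ∈ S, p x = 0
  · obtain ⟨x₀, hx₀, h0⟩ := hzero
    exact hreduce p x₀ hx₀ h0 hp hsum hmean μ hμ
  push Not at hzero
  have hpos : ∀ x ∈ S, 0 < p x := fun x hx => lt_of_le_of_ne (hp x hx) (hzero x hx).symm
  by_cases hcard : S.card ≤ 2
  · obtain ⟨a, ha, b, hb, hay, hyb, hab⟩ :=
      h.exists_threshold_of_card_le_two hlr hy hS hpos hsum hmean hcard
    obtain ⟨hmem, hlaw⟩ := h.hasLaw_atomicLaw (h.isStoppingTime_thresholdTime a b) hsum hab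
    have hcl : ∀ x ∈ Set.Icc l r, (x : EReal) ∈ closure ((fun z : ℝ => (z : EReal)) '' I) :=
      fun x hx => subset_closure ⟨x, interior_subset (hlr hx), rfl⟩
    refine ⟨thresholdTime Y a b, ⟨hmem, a, b, hcl a ha, hcl b hb, EReal.coe_le_coe_iff.2 hay,
      EReal.coe_le_coe_iff.2 hyb, rfl⟩, (hV _ hmem μ ?_).ge⟩
    rw [hμ]
    exact hlaw
  have hne : S.Nonempty := by
    rw [← Finset.card_pos]
    omega
  set a := S.min' hne with ha
  set c := S.max' hne with hc
  have haS : a ∈ S := S.min'_mem hne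
  have hcS : c ∈ S := S.max'_mem hne
  obtain ⟨b, hb⟩ : ((S.erase a).erase c).Nonempty := by
    rw [← Finset.card_pos]
    have h1 := Finset.pred_card_le_card_erase (s := S) (a := a)
    have h2 := Finset.pred_card_le_card_erase (s := S.erase a) (a := c)
    omega
  obtain ⟨hbc, hb'⟩ := Finset.mem_erase.1 hb
  obtain ⟨hba, hbS⟩ := Finset.mem_erase.1 hb'
  have hab : a < b := lt_of_le_of_ne (S.min'_le b hbS) hba.symm
  have hbc : b < c := lt_of_le_of_ne (S.le_max' b hbS) hbc
  have hac := hab.trans hbc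
  set s := hitProb κ r l with hs
  have hmono := hκ.strictMonoOn_hitProb hlr
  have hsab : s a < s b := hmono (hS a haS) (hS b hbS) hab
  have hsbc : s b < s c := hmono (hS b hbS) (hS c hcS) hbc
  set α := s c - s b with hα
  set γ := s b - s a with hγ
  have hα0 : 0 < α := sub_pos.2 hsbc
  have hγ0 : 0 < γ := sub_pos.2 hsab
  -- A direction supported on three atoms that preserves both total mass and scale mean; it moves
  -- mass between the middle atom and the outer two.
  set η : ℝ → ℝ := fun x =>
    (if x = a then α else 0) - (if x = b then α + γ else 0) + (if x = c then γ else 0) with hη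
  have hηa : η a = α := by simp [hη, hab.ne, hac.ne]
  have hηb : η b = -(α + γ) := by simp [hη, hab.ne', hbc.ne]
  have hηc : η c = γ := by simp [hη, hbc.ne', hac.ne']
  have hηx : ∀ x, x ≠ a → x ≠ b → x ≠ c → η x = 0 := by
    intro x h1 h2 h3
    simp [hη, h1, h2, h3]
  have hηsum : ∑ x ∈ S, η x = 0 := by
    simp only [hη, Finset.sum_add_distrib, Finset.sum_sub_distrib, Finset.sum_ite_eq', haS, hbS,
      hcS, if_true]
    ring
  have hηmean : ∑ x ∈ S, η x * s x = 0 := by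
    simp only [hη, add_mul, sub_mul, ite_mul, zero_mul, Finset.sum_add_distrib,
      Finset.sum_sub_distrib, Finset.sum_ite_eq', haS, hbS, hcS, if_true]
    rw [hα, hγ]
    ring
  -- The largest steps forwards and backwards along `η` that keep the weights nonnegative. The first
  -- removes the atom `b`, the second removes `a` or `c`.
  set t₁ := p b / (α + γ) with ht₁
  set t₂ := min (p a / α) (p c / γ) with ht₂
  have ht₁0 : 0 < t₁ := div_pos (hpos b hbS) (by positivity)
  have ht₂0 : 0 < t₂ := lt_min (div_pos (hpos a haS) hα0) (div_pos (hpos c hcS) hγ0)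
  have hsum' : ∀ t : ℝ, ∑ x ∈ S, (p x + t * η x) = 1 := by
    intro t
    rw [Finset.sum_add_distrib, ← Finset.mul_sum, hηsum, hsum]
    ring
  have hmean' : ∀ t : ℝ, ∑ x ∈ S, (p x + t * η x) * s x = s y := by
    intro t
    simp only [add_mul, mul_assoc]
    rw [Finset.sum_add_distrib, ← Finset.mul_sum, hηmean, hmean]
    ring
  have hb0 : p b + t₁ * η b = 0 := by
    rw [hηb, ht₁]
    field_simp
    ring
  have h2a : t₂ * α ≤ p a := (le_div_iff₀ hα0).1 (min_le_left _ _)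
  have h2c : t₂ * γ ≤ p c := (le_div_iff₀ hγ0).1 (min_le_right _ _)
  have hcases : ∀ {Q : ℝ → Prop}, Q a → Q b → Q c → (∀ x ∈ S, x ≠ a → x ≠ b → x ≠ c → Q x) →
      ∀ x ∈ S, Q x := by
    intro Q h1 h2 h3 h4 x hx
    by_cases hxa : x = a
    · exact hxa ▸ h1
    by_cases hxb : x = b
    · exact hxb ▸ h2
    by_cases hxc : x = c
    · exact hxc ▸ h3
    exact h4 x hx hxa hxb hxc
  have hpa := hpos a haS
  have hpb := hpos b hbS
  have hpc := hpos c hcS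
  have hp₁ : ∀ x ∈ S, 0 ≤ p x + t₁ * η x := by
    refine hcases ?_ hb0.ge ?_ ?_
    · rw [hηa]
      positivity
    · rw [hηc]
      positivity
    · intro x hx h1 h2 h3
      rw [hηx x h1 h2 h3, mul_zero, add_zero]
      exact hp x hx
  have hp₂ : ∀ x ∈ S, 0 ≤ p x + -t₂ * η x := by
    refine hcases ?_ ?_ ?_ ?_
    · rw [hηa]
      linarith
    · rw [hηb, neg_mul_neg]
      positivity
    · rw [hηc]
      linarith
    · intro x hx h1 h2 h3
      rw [hηx x h1 h2 h3, mul_zero, add_zero]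
      exact hp x hx
  obtain ⟨x₂, hx₂, hx₂0⟩ : ∃ x ∈ S, p x + -t₂ * η x = 0 := by
    rcases min_choice (p a / α) (p c / γ) with hm | hm
    · refine ⟨a, haS, ?_⟩
      rw [hηa, ht₂, hm]
      field_simp
      ring
    · refine ⟨c, hcS, ?_⟩
      rw [hηc, ht₂, hm]
      field_simp
      ring
  -- Quasi-convexity is assumed only between attainable laws, so the perturbed laws have to be
  -- embedded by stopping times.
  have hlawmem : ∀ (q : ℝ → ℝ), (∀ x ∈ S, 0 ≤ q x) → ∑ x ∈ S, q x = 1 →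
      ∑ x ∈ S, q x * s x = s y → ∀ ν : ProbabilityMeasure EReal,
      (ν : Measure EReal) = atomicLaw S q → ν ∈ exitLaws P Y (stoppingClass 𝓕 P Y) := by
    intro q hq hqs hqm ν hν
    obtain ⟨τ, hτ, hτq⟩ := h.exists_embedding hlr hy S q hS hq hqs hqm
    obtain ⟨h1, h2⟩ := h.hasLaw_atomicLaw hτ hqs hτq
    exact ⟨τ, h1, by rwa [hν]⟩
  let μ₁ : ProbabilityMeasure EReal :=
    ⟨atomicLaw S fun x => p x + t₁ * η x, isProbabilityMeasure_atomicLaw hp₁ (hsum' t₁)⟩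
  let μ₂ : ProbabilityMeasure EReal :=
    ⟨atomicLaw S fun x => p x + -t₂ * η x, isProbabilityMeasure_atomicLaw hp₂ (hsum' (-t₂))⟩
  -- The weight `t₂ / (t₁ + t₂)` balances the steps `t₁` and `-t₂`, so that the mixture is the
  -- original law.
  have hle := hH μ₁ (hlawmem _ hp₁ (hsum' _) (hmean' _) μ₁ rfl) μ₂
    (hlawmem _ hp₂ (hsum' _) (hmean' _) μ₂ rfl) μ (hlawmem p hp hsum hmean μ hμ)
    (t₂ / (t₁ + t₂)) (by positivity) (by rw [div_lt_one (by positivity)]; linarith) (by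
      rw [hμ]
      refine atomicLaw_mixture (by positivity) (by rw [div_le_one (by positivity)]; linarith)
        hp₁ hp₂ fun x _ => ?_
      field_simp
      ring)
  obtain ⟨τ₁, hτ₁, hle₁⟩ := hreduce _ b hbS hb0 hp₁ (hsum' _) (hmean' _) μ₁ rfl
  obtain ⟨τ₂, hτ₂, hle₂⟩ := hreduce _ x₂ hx₂ hx₂0 hp₂ (hsum' _) (hmean' _) μ₂ rfl
  rcases le_max_iff.1 hle with hle | hle
  · exact ⟨τ₁, hτ₁, hle.trans hle₁⟩
  · exact ⟨τ₂, hτ₂, hle.trans hle₂⟩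

end IsDiffusionFrom

/-! ### Finite nets, exhaustion by compact intervals, and discretization -/

theorem exists_finset_net {l r ε : ℝ} (hlr : l ≤ r) (hε : 0 < ε) :
    ∃ G : Finset ℝ, l ∈ G ∧ r ∈ G ∧ (∀ x ∈ G, x ∈ Set.Icc l r) ∧
      ∀ x ∈ Set.Icc l r, ∃ g ∈ G, ∃ g' ∈ G, g ≤ x ∧ x ≤ g' ∧ g' - g ≤ ε := by
  classical
  set G : Finset ℝ :=
    insert l (insert r (((Finset.Icc ⌈l / ε⌉ ⌊r / ε⌋)).image fun k : ℤ => (k : ℝ) * ε)) with hG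
  have hmem : ∀ k : ℤ, l ≤ k * ε → k * ε ≤ r → (k : ℝ) * ε ∈ G := by
    intro k h1 h2
    refine Finset.mem_insert_of_mem (Finset.mem_insert_of_mem (Finset.mem_image_of_mem _ ?_))
    exact Finset.mem_Icc.2 ⟨Int.ceil_le.2 ((div_le_iff₀ hε).2 h1),
      Int.le_floor.2 ((le_div_iff₀ hε).2 h2)⟩
  refine ⟨G, by simp [hG], by simp [hG], ?_, ?_⟩
  · intro x hx
    simp only [hG, Finset.mem_insert, Finset.mem_image, Finset.mem_Icc] at hx
    rcases hx with rfl | rfl | ⟨k, ⟨h1, h2⟩, rfl⟩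
    · exact ⟨le_rfl, hlr⟩
    · exact ⟨hlr, le_rfl⟩
    · exact ⟨(div_le_iff₀ hε).1 (Int.ceil_le.1 h1), (le_div_iff₀ hε).1 (Int.le_floor.1 h2)⟩
  · intro x hx
    have h1 : (⌊x / ε⌋ : ℝ) * ε ≤ x := (le_div_iff₀ hε).1 (Int.floor_le _)
    have h2 : x ≤ ((⌊x / ε⌋ + 1 : ℤ) : ℝ) * ε := by
      push_cast
      exact (div_le_iff₀ hε).1 (Int.lt_floor_add_one _).le
    have h3 : ((⌊x / ε⌋ + 1 : ℤ) : ℝ) * ε = (⌊x / ε⌋ : ℝ) * ε + ε := by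
      push_cast
      ring
    refine ⟨max l ((⌊x / ε⌋ : ℝ) * ε), ?_, min r (((⌊x / ε⌋ + 1 : ℤ) : ℝ) * ε), ?_,
      max_le hx.1 h1, le_min hx.2 h2, ?_⟩
    · rcases max_choice l ((⌊x / ε⌋ : ℝ) * ε) with hm | hm <;> rw [hm]
      · simp [hG]
      · exact hmem _ (max_eq_right_iff.1 hm) (h1.trans hx.2)
    · rcases min_choice r (((⌊x / ε⌋ + 1 : ℤ) : ℝ) * ε) with hm | hm <;> rw [hm]
      · simp [hG]
      · exact hmem _ (hx.1.trans h2) (min_eq_right_iff.1 hm)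
    · have h4 := le_max_right l ((⌊x / ε⌋ : ℝ) * ε)
      have h5 := min_le_right r (((⌊x / ε⌋ + 1 : ℤ) : ℝ) * ε)
      linarith

/-- Running maxima of a dense sequence in `U` treat bounded and unbounded `U` alike. -/
theorem IsOpen.exists_monotone_exhaustion {U : Set ℝ} (hU : IsOpen U) {y : ℝ} (hy : y ∈ U) :
    ∃ r : ℕ → ℝ, Monotone r ∧ (∀ n, y < r n ∧ r n ∈ U) ∧ ∀ z ∈ U, ∃ n, z < r n := by
  have habove : ∀ z ∈ U, ∃ w ∈ U, z < w := by
    intro z hz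
    obtain ⟨w, hw, hsub⟩ := exists_Ico_subset_of_mem_nhds (hU.mem_nhds hz) ⟨z + 1, by simp⟩
    obtain ⟨v, hv1, hv2⟩ := exists_between hw
    exact ⟨v, hsub ⟨hv1.le, hv2⟩, hv1⟩
  obtain ⟨r₀, hr₀U, hr₀⟩ := habove y hy
  have : Nonempty U := ⟨⟨y, hy⟩⟩
  set u := TopologicalSpace.denseSeq U with hu
  set r : ℕ → ℝ := fun n => Nat.rec r₀ (fun k x => max x (u k)) n with hr
  have hsucc : ∀ n, r (n + 1) = max (r n) (u n) := fun n => rfl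
  have hmono : Monotone r := monotone_nat_of_le_succ fun n => by
    rw [hsucc]
    exact le_max_left _ _
  refine ⟨r, hmono, fun n => ⟨hr₀.trans_le (hmono (Nat.zero_le n)), ?_⟩, fun z hz => ?_⟩
  · induction n with
    | zero => exact hr₀U
    | succ n ih =>
      rw [hsucc]
      rcases max_choice (r n) (u n) with hm | hm <;> rw [hm]
      · exact ih
      · exact (u n).2
  · obtain ⟨w, hwU, hzw⟩ := habove z hz
    obtain ⟨n, hv⟩ := (TopologicalSpace.denseRange_denseSeq U).exists_mem_open
      (isOpen_Ioi.preimage continuous_subtype_val : IsOpen {v : U | z < v}) ⟨⟨w, hwU⟩, hzw⟩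
    exact ⟨n + 1, by rw [hsucc]; exact lt_max_of_lt_right hv⟩

theorem Set.OrdConnected.exists_exhaustion {U : Set ℝ} (hU : IsOpen U) (hU' : U.OrdConnected)
    {y : ℝ} (hy : y ∈ U) :
    ∃ l r : ℕ → ℝ, Antitone l ∧ Monotone r ∧ (∀ n, l n < y ∧ y < r n ∧ Set.Icc (l n) (r n) ⊆ U) ∧
      ∀ z ∈ U, ∃ n, l n < z ∧ z < r n := by
  obtain ⟨r, hr, hrU, hrz⟩ := hU.exists_monotone_exhaustion hy
  obtain ⟨l, hl, hlU, hlz⟩ := (hU.preimage continuous_neg).exists_monotone_exhaustion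
    (y := -y) (by simpa using hy)
  refine ⟨fun n => -l n, r, hl.neg, hr, fun n => ⟨by linarith [(hlU n).1], (hrU n).1,
    hU'.out (hlU n).2 (hrU n).2⟩, fun z hz => ?_⟩
  obtain ⟨n, hn⟩ := hrz z hz
  obtain ⟨k, hk⟩ := hlz (-z) (by simpa using hz)
  refine ⟨max n k, ?_, hn.trans_le (hr (le_max_left _ _))⟩
  have := hl (le_max_right n k)
  change -l (max n k) < z
  linarith

/-- The position at `τ ∧ T_n`, where `T_n` is the exit time from the `n`-th interval of an
exhaustion, converges to the stopped value. -/
theorem tendsto_min_exit {Ω : Type*} {Y : Ω → C(ℝ≥0, ℝ)} {τ : Ω → WithTop ℝ≥0} {ω : Ω} {U : Set ℝ}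
    {l r : ℕ → ℝ} (hl : Antitone l) (hr : Monotone r) (hU : ∀ z ∈ U, ∃ n, l n < z ∧ z < r n)
    (hstart : ∀ n, l n < Y ω 0 ∧ Y ω 0 < r n)
    (habs : ∀ t, Y ω t ∉ U → ∀ t' ≥ t, Y ω t' = Y ω t) {x : EReal}
    (hx : Tendsto (fun t : ℝ≥0 => ((stoppedProcess (fun t ω => Y ω t) τ t ω : ℝ) : EReal)) atTop
      (𝓝 x)) {s : ℕ → ℝ≥0} (hexit : ∀ n, hitFrom {l n, r n} 0 (Y ω) ≠ ⊤)
    (hs : ∀ n, min (τ ω) (hitFrom {l n, r n} 0 (Y ω)) = s n) :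
    Tendsto (fun n => (Y ω (s n) : EReal)) atTop (𝓝 x) := by
  choose T hT using fun n => WithTop.ne_top_iff_exists.1 (hexit n)
  have hTspec : ∀ n, Y ω (T n) ∈ ({l n, r n} : Set ℝ) := fun n =>
    (hitFrom_eq_coe (isClosed_pair _ _) (hT n).symm).2.1
  have hTmin : ∀ n (v : ℝ≥0), Y ω v ∈ ({l n, r n} : Set ℝ) → T n ≤ v := fun n v hv =>
    (hitFrom_eq_coe (isClosed_pair _ _) (hT n).symm).2.2 v (by simp) hv
  have hout : ∀ {n k}, n ≤ k → Y ω (T k) ≤ l n ∨ r n ≤ Y ω (T k) := by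
    intro n k hnk
    rcases hTspec k with h | h
    · exact Or.inl (h.trans_le (hl hnk))
    · exact Or.inr ((hr hnk).trans_eq (Eq.symm h))
  have hTmono : Monotone T := by
    intro n k hnk
    have hpass : ∀ e ∈ ({l n, r n} : Set ℝ), e ∈ Set.uIcc (Y ω 0) (Y ω (T k)) → T n ≤ T k := by
      intro e he hm
      obtain ⟨v, -, hvT, hv⟩ := exists_mem_of_mem_uIcc (Y ω) (zero_le (a := T k)) hm
      exact (hTmin n v (hv ▸ he)).trans hvT
    rcases hout hnk with h | h
    · exact hpass (l n) (by simp) (Set.mem_uIcc.2 (Or.inr ⟨h, (hstart n).1.le⟩))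
    · exact hpass (r n) (by simp) (Set.mem_uIcc.2 (Or.inl ⟨(hstart n).2.le, h⟩))
  -- Either `τ` occurs by some exit time and the sequence is eventually constant, or the positions
  -- are those at the exit times themselves.
  by_cases hA : ∃ N, τ ω ≤ T N
  · obtain ⟨N, hN⟩ := hA
    obtain ⟨t, ht⟩ := WithTop.ne_top_iff_exists.1 (hN.trans_lt (WithTop.coe_lt_top _)).ne
    have hxt : x = Y ω t := tendsto_nhds_unique hx (tendsto_stoppedProcess_of_eq_coe ht.symm)
    rw [hxt]
    refine tendsto_const_nhds.congr' ?_
    filter_upwards [eventually_ge_atTop N] with n hn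
    have h1 : min (τ ω) (hitFrom {l n, r n} 0 (Y ω)) = τ ω := by
      rw [← hT n]
      exact min_eq_left (hN.trans (WithTop.coe_le_coe.2 (hTmono hn)))
    have h2 : s n = t := by
      refine WithTop.coe_injective ?_
      rw [← hs n, h1, ht]
    rw [h2]
  push Not at hA
  have hsT : s = T := by
    funext n
    refine WithTop.coe_injective ?_
    rw [← hs n, ← hT n]
    exact min_eq_right (hA n).le
  rw [hsT]
  -- If the exit times tend to infinity, the sequence follows the stopped path. If they converge to
  -- a finite `ζ`, then `Y_ζ` lies outside every interval of the exhaustion, so the path is frozen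
  -- from `ζ` on and its limit is `Y_ζ`.
  rcases tendsto_atTop_of_monotone hTmono with htop | ⟨ζ, hζ⟩
  · refine (hx.comp htop).congr fun n => ?_
    simp only [Function.comp_apply]
    rw [stoppedProcess_eq_of_le (hA n).le]
  · have h1 : Tendsto (fun n => Y ω (T n)) atTop (𝓝 (Y ω ζ)) :=
      ((Y ω).continuous.tendsto ζ).comp hζ
    have h2 : Y ω ζ ∉ U := by
      intro hmem
      obtain ⟨N, hN⟩ := hU _ hmem
      have h3 := h1.eventually (isOpen_Ioo.mem_nhds (Set.mem_Ioo.2 hN))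
      obtain ⟨n, hn, hnN⟩ := (h3.and (eventually_ge_atTop N)).exists
      rcases hout hnN with h | h
      · exact absurd hn.1 (not_lt.2 h)
      · exact absurd hn.2 (not_lt.2 h)
    have hζτ : (ζ : WithTop ℝ≥0) ≤ τ ω :=
      le_of_tendsto' ((WithTop.continuous_coe.tendsto ζ).comp hζ) fun n => (hA n).le
    have h3 : x = Y ω ζ := by
      refine tendsto_nhds_unique hx (tendsto_const_nhds.congr' ?_)
      filter_upwards [eventually_ge_atTop ζ] with t ht
      rcases le_total (t : WithTop ℝ≥0) (τ ω) with h | h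
      · rw [stoppedProcess_eq_of_le h, habs ζ h2 t ht]
      · rw [stoppedProcess_eq_of_ge h]
        obtain ⟨w, hw⟩ := WithTop.ne_top_iff_exists.1 (h.trans_lt (WithTop.coe_lt_top _)).ne
        rw [← hw] at hζτ ⊢
        change ((Y ω ζ : ℝ) : EReal) = ((Y ω w : ℝ) : EReal)
        rw [habs ζ h2 w (WithTop.coe_le_coe.1 hζτ)]
    rw [h3]
    exact (continuous_coe_real_ereal.tendsto _).comp h1

namespace IsDiffusionFrom

variable {Ω : Type*} {m : MeasurableSpace Ω} {I : Set ℝ} {κ : Kernel ℝ C(ℝ≥0, ℝ)}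
  {𝓕 : Filtration ℝ≥0 m} {P : Measure Ω} {Y : Ω → C(ℝ≥0, ℝ)} {y l r : ℝ}

/-- The strong Markov property at the first exit from the interior, where absorption holds for the
restarted path. Comparing values at countably many dense times makes non-constancy a measurable
event. -/
theorem ae_absorbed (h : IsDiffusionFrom I κ 𝓕 P Y y) :
    ∀ᵐ ω ∂P, ∀ t, Y ω t ∉ interior I → ∀ t' ≥ t, Y ω t' = Y ω t := by
  have hC : IsClosed (interior I)ᶜ := isOpen_interior.isClosed_compl
  have hτ := hC.isStoppingTime_hitFrom h.adapted (isStoppingTime_const 𝓕 0)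
  obtain ⟨D, hDc, hDd⟩ := TopologicalSpace.exists_countable_dense ℝ≥0
  set Γ : Set C(ℝ≥0, ℝ) := ⋃ q ∈ D, {f | f q ≠ f 0} with hΓ
  have hΓm : MeasurableSet Γ := MeasurableSet.biUnion hDc fun q _ =>
    (measurableSet_eq_fun (measurable_path_eval q) (measurable_path_eval 0)).compl
  have hA : MeasurableSet[hτ.measurableSpace]
      {ω | hitFrom (interior I)ᶜ (0 : ℝ≥0) (Y ω) ≠ ⊤} :=
    ((measurableSet_singleton _).preimage hτ.measurable).compl
  have h1 := h.measure_shift_le hτ hA (fun ω hω => hω) hΓm (c := 0) (by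
    filter_upwards [h.ae_mem] with ω hω _ t ht
    have hmem : Y ω t ∈ I \ interior I := ⟨hω t, (hitFrom_eq_coe hC ht).2.1⟩
    refine le_of_eq (measure_eq_zero_iff_ae_notMem.2 ?_)
    filter_upwards [h.diffusion.absorbing _ hmem] with f hf
    simp [hΓ, hf])
  rw [zero_mul, nonpos_iff_eq_zero] at h1
  filter_upwards [measure_eq_zero_iff_ae_notMem.1 h1] with ω hω t ht t' htt'
  obtain ⟨t₀, ht₀, -, -, hmin⟩ := exists_hitFrom_eq hC (u := (0 : ℝ≥0)) (f := Y ω)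
    ⟨t, by simp, ht⟩
  have hle : t₀ ≤ t := hmin t (by simp) ht
  have hnot : shiftPath t₀ (Y ω) ∉ Γ := fun hmem =>
    hω ⟨show hitFrom (interior I)ᶜ (0 : ℝ≥0) (Y ω) ≠ ⊤ by rw [ht₀]; exact WithTop.coe_ne_top,
      t₀, ht₀, hmem⟩
  have hconst : ∀ u, Y ω (t₀ + u) = Y ω t₀ := by
    have heq : Set.EqOn (fun u => shiftPath t₀ (Y ω) u) (fun _ => shiftPath t₀ (Y ω) 0) D := by
      intro q hq
      by_contra hne
      exact hnot (Set.mem_biUnion hq hne)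
    have := Continuous.ext_on hDd (shiftPath t₀ (Y ω)).continuous continuous_const heq
    intro u
    simpa using congrFun this u
  have e1 := hconst (t - t₀)
  have e2 := hconst (t' - t₀)
  rw [add_tsub_cancel_of_le hle] at e1
  rw [add_tsub_cancel_of_le (hle.trans htt')] at e2
  rw [e1, e2]

/-- A stopping time is approximated by one at which the diffusion is, before it leaves `[l, r]`, in
a given finite set. The exit value of the latter has the value of a threshold rule as an upper
bound. -/
theorem exists_discretization (h : IsDiffusionFrom I κ 𝓕 P Y y) (hlr : Set.Icc l r ⊆ interior I)
    (hly : l < y) (hyr : y < r) {τ : Ω → WithTop ℝ≥0} (hτ : IsStoppingTime 𝓕 τ) {ε : ℝ}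
    (hε : 0 < ε) :
    ∃ τ' : Ω → WithTop ℝ≥0, IsStoppingTime 𝓕 τ' ∧
      (∃ (S : Finset ℝ) (p : ℝ → ℝ), (∀ x ∈ S, x ∈ Set.Icc l r) ∧ (∀ x ∈ S, 0 ≤ p x) ∧
        ∑ x ∈ S, p x = 1 ∧ ∑ x ∈ S, p x * hitProb κ r l x = hitProb κ r l y ∧
        ∀ x ∈ S, p x ≤ P.real {ω | ∃ t : ℝ≥0, τ' ω = t ∧ Y ω t = x}) ∧
      ∀ᵐ ω ∂P, hitFrom {l, r} 0 (Y ω) ≠ ⊤ ∧ ∃ t s : ℝ≥0, τ' ω = t ∧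
        min (τ ω) (hitFrom {l, r} 0 (Y ω)) = s ∧ |Y ω t - Y ω s| ≤ ε := by
  have := h.prob
  have hltr := hly.trans hyr
  obtain ⟨G, hlG, hrG, hG, hnet⟩ := exists_finset_net hltr.le hε
  have hGc : IsClosed (G : Set ℝ) := G.finite_toSet.isClosed
  -- Since `l` and `r` belong to the net `G`, the first visit to `G` from `σ` on comes no later than
  -- the exit from `[l, r]`; this permits optional stopping there.
  set σ : Ω → WithTop ℝ≥0 := fun ω => min (τ ω) (hitFrom {l, r} 0 (Y ω)) with hσ
  have hσs : IsStoppingTime 𝓕 σ := hτ.min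
    ((isClosed_pair l r).isStoppingTime_hitFrom h.adapted (isStoppingTime_const 𝓕 0))
  have hτ's := hGc.isStoppingTime_hitFrom h.adapted hσs
  have hyI : y ∈ Set.uIcc l r := by
    rw [Set.uIcc_of_le hltr.le]
    exact ⟨hly.le, hyr.le⟩
  have hexit := h.ae_path
    (h.diffusion.ae_exit (by rwa [Set.uIcc_of_le hltr.le]) hyI)
  have key : ∀ᵐ ω ∂P, ∃ T s t : ℝ≥0, hitFrom {l, r} 0 (Y ω) = T ∧ σ ω = s ∧ s ≤ T ∧
      hitFrom G (σ ω) (Y ω) = t ∧ Y ω t ∈ G ∧ Y ω s ∈ Set.Icc l r ∧ s ≤ t ∧ t ≤ T ∧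
      ∀ v, s ≤ v → Y ω v ∈ G → t ≤ v := by
    filter_upwards [hexit, h.start] with ω hω h0
    obtain ⟨v, hv⟩ := hω
    obtain ⟨T, hT, -, hTm, hTmin⟩ := exists_hitFrom_eq (isClosed_pair l r) (u := 0) (f := Y ω)
      ⟨v, by simp, hv⟩
    have hσT : σ ω ≤ T := (min_le_right _ _).trans hT.le
    obtain ⟨s, hs⟩ := WithTop.ne_top_iff_exists.1 (hσT.trans_lt (WithTop.coe_lt_top _)).ne
    have hsT : s ≤ T := by
      rw [← hs] at hσT
      exact WithTop.coe_le_coe.1 hσT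
    have hTG : Y ω T ∈ (G : Set ℝ) := by
      rcases hTm with hm | hm <;> rw [hm]
      · exact hlG
      · exact hrG
    obtain ⟨t, ht, hst, htG, htmin⟩ := exists_hitFrom_eq hGc (u := σ ω) (f := Y ω) ⟨T, hσT, hTG⟩
    rw [← hs] at hst
    refine ⟨T, s, t, hT, hs.symm, hsT, ht, htG, ?_, WithTop.coe_le_coe.1 hst, htmin T hσT hTG, ?_⟩
    · rcases hsT.eq_or_lt with rfl | hlt
      · exact hG _ hTG
      · rw [← Set.uIcc_of_le hltr.le]
        refine mem_uIcc_of_avoids (f := Y ω) (by rw [h0]; exact hyI) fun w hw hwm => ?_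
        exact absurd (hTmin w (by simp) hwm) (not_le.2 (hw.trans_lt hlt))
    · exact fun w hw hwG => htmin w (by rw [← hs]; exact WithTop.coe_le_coe.2 hw) hwG
  set E : ℝ → Set Ω := fun x => {ω | ∃ t : ℝ≥0, hitFrom G (σ ω) (Y ω) = t ∧ Y ω t = x} with hE
  have hEm : ∀ x ∈ G, MeasurableSet (E x) := fun x _ => h.measurableSet_stopped_eq hτ's x
  refine ⟨fun ω => hitFrom G (σ ω) (Y ω), hτ's, ⟨G, fun x => P.real (E x), hG,
    fun x _ => measureReal_nonneg, ?_, ?_, fun x _ => le_rfl⟩, ?_⟩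
  · rw [← measureReal_biUnion_finset (pairwiseDisjoint_stopped_eq Y _ _) hEm]
    have h1 : (⋃ x ∈ G, E x : Set Ω) =ᵐ[P] (Set.univ : Set Ω) := by
      filter_upwards [key] with ω hω
      obtain ⟨T, s, t, -, -, -, ht, htG, -⟩ := hω
      exact eq_true (show ω ∈ ⋃ x ∈ G, E x from Set.mem_biUnion htG ⟨t, ht, rfl⟩)
    rw [measureReal_congr h1, probReal_univ]
  · refine (h.hitProb_eq_sum hτ's ?_).symm
    filter_upwards [key] with ω hω
    obtain ⟨T, s, t, hT, -, hsT, ht, htG, -, hst, htT, htmin⟩ := hω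
    refine ⟨t, ht, htG, fun v hv => ?_⟩
    have hv' : Y ω v ∉ ({l, r} : Set ℝ) := fun hm =>
      absurd (htT.trans ((hitFrom_eq_coe (isClosed_pair l r) hT).2.2 v (by simp) hm)) (not_le.2 hv)
    simpa using hv'
  · filter_upwards [key] with ω hω
    obtain ⟨T, s, t, hT, hs, hsT, ht, htG, hsI, hst, htT, htmin⟩ := hω
    refine ⟨by simp [hT], t, s, ht, hs, ?_⟩
    -- Between `σ` and the visit to `G` the path cannot cross the net points on either side of
    -- `Y_σ`, so it moves by at most `ε`.
    obtain ⟨g, hg, g', hg', h1, h2, h3⟩ := hnet _ hsI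
    have hpass : ∀ e ∈ G, e ∈ Set.uIcc (Y ω s) (Y ω t) → Y ω t = e := by
      intro e he hm
      obtain ⟨v, hv1, hv2, hv⟩ := exists_mem_of_mem_uIcc (Y ω) hst hm
      rw [le_antisymm (htmin v hv1 (hv ▸ he)) hv2, hv]
    have h4 : g ≤ Y ω t := by
      by_contra hlt
      push Not at hlt
      exact hlt.ne (hpass g hg (Set.mem_uIcc.2 (Or.inr ⟨hlt.le, h1⟩)))
    have h5 : Y ω t ≤ g' := by
      by_contra hlt
      push Not at hlt
      exact hlt.ne' (hpass g' hg' (Set.mem_uIcc.2 (Or.inl ⟨h2, hlt.le⟩)))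
    rw [abs_le]
    constructor <;> linarith

end IsDiffusionFrom

/-! ### Passage to the limit -/

theorem theorem2 {Ω : Type*} {m : MeasurableSpace Ω} (P : Measure Ω) [IsProbabilityMeasure P]
    (𝓕 : Filtration ℝ≥0 m)
    (I : Set ℝ) (κ : Kernel ℝ C(ℝ≥0, ℝ)) (hκ : IsRegularDiffusion I κ)
    (y : ℝ) (hy : y ∈ interior I)
    (Y : Ω → C(ℝ≥0, ℝ)) (hY_adapted : Adapted 𝓕 (fun t ω => Y ω t))
    (hY_start : ∀ᵐ ω ∂P, Y ω 0 = y) (hY_markov : IsStrongMarkov κ 𝓕 P Y)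
    (V : (Ω → WithTop ℝ≥0) → ℝ) (H : ProbabilityMeasure EReal → ℝ)
    (hV : ∀ τ ∈ stoppingClass 𝓕 P Y, ∀ μ : ProbabilityMeasure EReal,
      HasLaw (exitValue Y τ) (μ : Measure EReal) P → V τ = H μ)
    (hH_qc : IsQuasiconvexOn (exitLaws P Y (stoppingClass 𝓕 P Y)) H)
    (hH_lsc : IsLimsupLscOn (exitLaws P Y (stoppingClass 𝓕 P Y)) H) :
    optimalValue V (stoppingClass 𝓕 P Y) = optimalValue V (thresholdClass 𝓕 P Y I y) := by
  have h : IsDiffusionFrom I κ 𝓕 P Y y :=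
    ⟨hκ, inferInstance, interior_subset hy, hY_adapted, hY_start, hY_markov⟩
  refine le_antisymm (iSup₂_le fun τ hτ => ?_) (biSup_mono fun τ hτ => hτ.1)
  obtain ⟨l, r, hl, hr, hlr, hexh⟩ := Set.OrdConnected.exists_exhaustion isOpen_interior
    hκ.ordConnected.interior hy
  have hε : ∀ n : ℕ, 0 < 1 / ((n : ℝ) + 1) := fun n => by positivity
  choose τ' hτ's hlaw hclose using fun n =>
    h.exists_discretization (hlr n).2.2 (hlr n).1 (hlr n).2.1 hτ.1 (hε n)
  choose S p hS hp hsum hmean hle using hlaw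
  have hmem := fun n => h.hasLaw_atomicLaw (hτ's n) (hsum n) (hle n)
  have hτ'm := fun n => h.aemeasurable_exitValue (hmem n).1
  have hτm := h.aemeasurable_exitValue hτ
  set μ : ProbabilityMeasure EReal :=
    ⟨P.map (exitValue Y τ), Measure.isProbabilityMeasure_map hτm⟩ with hμ
  set ν : ℕ → ProbabilityMeasure EReal := fun n =>
    ⟨P.map (exitValue Y (τ' n)), Measure.isProbabilityMeasure_map (hτ'm n)⟩ with hν
  have hlim : ∀ᵐ ω ∂P, Tendsto (fun n => exitValue Y (τ' n) ω) atTop (𝓝 (exitValue Y τ ω)) := by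
    filter_upwards [ae_all_iff.2 hclose, hτ.2, h.start, h.ae_absorbed] with ω hω hlim h0 habs
    obtain ⟨x, hx⟩ := hlim
    choose hfin t s ht hs hts using hω
    have h1 := tendsto_min_exit hl hr hexh
      (fun n => by rw [h0]; exact ⟨(hlr n).1, (hlr n).2.1⟩) habs hx hfin hs
    have h2 : Tendsto (fun n => Y ω (t n) - Y ω (s n)) atTop (𝓝 0) :=
      squeeze_zero_norm hts tendsto_one_div_add_atTop_nhds_zero_nat
    have h3 : Tendsto (fun n => ((Y ω (t n) - Y ω (s n) : ℝ) : EReal)) atTop (𝓝 ((0 : ℝ) : EReal)) :=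
      (continuous_coe_real_ereal.tendsto _).comp h2
    -- The limit `x` may be infinite, but addition of extended reals is continuous at `(x, 0)`
    -- because the second entry is finite.
    have h4 := (EReal.continuousAt_add (p := (x, ((0 : ℝ) : EReal))) (by simp) (by simp)).tendsto.comp
      (h1.prodMk_nhds h3)
    rw [exitValue_eq_of_tendsto hx]
    refine (h4.congr fun n => ?_).trans_eq (by simp)
    simp only [Function.comp_apply]
    rw [exitValue_of_eq_coe (ht n), ← EReal.coe_add]
    congr 1
    ring
  have hweak : Tendsto ν atTop (𝓝 μ) := (tendstoInDistribution_of_ae_tendsto hτ'm hτm hlim).tendsto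
  have hVτ : V τ = H μ := hV τ hτ μ ⟨hτm, rfl⟩
  rw [hVτ]
  refine (hH_lsc ν μ (fun n => ⟨τ' n, (hmem n).1, hτ'm n, rfl⟩) ⟨τ, hτ, hτm, rfl⟩ hweak).trans ?_
  refine limsup_le_of_le (by isBoundedDefault) (Eventually.of_forall fun n => ?_)
  obtain ⟨θ, hθ, hHθ⟩ := h.exists_threshold_ge (hlr n).2.2 ⟨(hlr n).1.le, (hlr n).2.1.le⟩ hV hH_qc
    (S n) (p n) (hS n) (hp n) (hsum n) (hmean n) (ν n) (hmem n).2.map_eq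
  exact (EReal.coe_le_coe_iff.2 hHθ).trans (le_iSup₂ (f := fun τ _ => (V τ : EReal)) θ hθ)
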